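/- Let $M>0$ and let $r=r(u)>2M$ be the inverse of the Regge--Wheeler coordinate $u(r)=r+2M\log\left(\frac{r}{2M}-1\right)$, $r>2M$. Put $$V_0(u)=\left(1-\frac{2M}{r(u)}\right)\frac{2M}{r(u)^3},\qquad u\in\mathbb R .$$ For real $\omega\neq 0$ let $\acute\phi_\omega=\sum_{k\ge 0}\acute\phi^{(k)}_\omega$ and $\grave\phi_\omega=\sum_{k\ge 0}\grave\phi^{(k)}_\omega$ be the Jost solutions, where $\acute\phi^{(0)}_\omega(u)=e^{i\omega u}$, $\grave\phi^{(0)}_\omega(u)=e^{-i\omega u}$ and $$\acute\phi^{(k+1)}_\omega(u)=\int_{-\infty}^u\frac{\sin(\omega(u-v))}{\omega}V_0(v)\,\acute\phi^{(k)}_\omega(v)\,dv,\qquad \grave\phi^{(k+1)}_\omega(u)=-\int_u^{\infty}\frac{\sin(\omega(u-v))}{\omega}V_0(v)\,\grave\phi^{(k)}_\omega(v)\,dv ,$$ and let $w(\acute\phi_\omega,\grave\phi_\omega)=\acute\phi_\omega\grave\phi_\omega'-\acute\phi_\omega'\grave\phi_\omega$ be their Wronskian. Let $u\in\mathbb R$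 be fixed and let $\Psi_0\in C_0^\infty(\mathbb R,\mathbb C^2)$. For real $\omega\ne 0$ the functions $\acute\phi_\omega,\grave\phi_\omega$ are $C^2$ solutions of $\left(-\partial_x^2-\omega^2+V_0(x)\right)\phi(x)=0$ on $\mathbb R$ with $$\lim_{x\to-\infty}e^{-i\omega x}\acute\phi_\omega(x)=1,\quad \lim_{x\to-\infty}\left(e^{-i\omega x}\acute\phi_\omega(x)\right)'=0,\quad \lim_{x\to+\infty}e^{i\omega x}\grave\phi_\omega(x)=1,\quad \lim_{x\to+\infty}\left(e^{i\omega x}\grave\phi_\omega(x)\right)'=0,$$ their Wronskian does not vanish, and the integral $$F(\omega)=\int_{\mathrm{supp}\,\Psi_0}\mathrm{Im}\left(\frac{\acute\phi_\omega(u)\,\grave\phi_\omega(v)}{w(\acute\phi_\omega,\grave\phi_\omega)}\right)\begin{pmatrix}\omega&1\\ \omega^2&\omega\end{pmatrix}\Psi_0(v)\,dv\in\mathbb C^2$$ converges absolutely. The function $F$ is four times continuously differentiable on $\mathbb R\setminus\{0\}$, and $F$ and its derivatives up to the fourth order have arbitrary polynomial decay: for all $m\in\{0,\dots,4\}$ and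 $N\in\mathbb N$ there are constants $C$ and $R>0$ such that $$\left\|\partial_\omega^mF(\omega)\right\|\le\frac{C}{|\omega|^N}\qquad\text{for all real }\omega\text{ with }|\omega|\ge R .$$ -/

import Mathlib

noncomputable section

namespace Schwarzschild

/-- The Regge-Wheeler coordinate `u(r) = r + 2M log (r / 2M - 1)` on `r > 2M`. -/
def tortoise (M r : ℝ) : ℝ := r + 2 * M * Real.log (r / (2 * M) - 1)

theorem tortoise_strictMonoOn {M : ℝ} (hM : 0 < M) :
    StrictMonoOn (tortoise M) (Set.Ioi (2 * M)) := by
  intro a ha b _ hab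
  have h2 : 0 < 2 * M := by positivity
  have ha' : 1 < a / (2 * M) := (one_lt_div h2).2 ha
  have hlt : a / (2 * M) < b / (2 * M) := div_lt_div_of_pos_right hab h2
  have hlog : Real.log (a / (2 * M) - 1) < Real.log (b / (2 * M) - 1) :=
    Real.log_lt_log (by linarith) (by linarith)
  have := mul_lt_mul_of_pos_left hlog h2
  simp only [tortoise]
  linarith

theorem tortoise_surjOn {M : ℝ} (hM : 0 < M) (u : ℝ) :
    ∃ r ∈ Set.Ioi (2 * M), tortoise M r = u := by
  have h2 : 0 < 2 * M := by positivity
  -- write `r = 2M (1 + exp s)`; then the coordinate is `2M (1 + exp s + s)`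
  have hval : ∀ s : ℝ, tortoise M (2 * M * (1 + Real.exp s)) = 2 * M * (1 + Real.exp s + s) := by
    intro s
    have : 2 * M * (1 + Real.exp s) / (2 * M) - 1 = Real.exp s := by
      field_simp
      ring
    rw [tortoise, this, Real.log_exp]
    ring
  have hc : Continuous fun s : ℝ => 2 * M * (1 + Real.exp s + s) := by fun_prop
  have hlow : 2 * M * (1 + Real.exp (-|u / (2 * M)| - 2) + (-|u / (2 * M)| - 2)) ≤ u := by
    have h1 : Real.exp (-|u / (2 * M)| - 2) ≤ 1 :=
      Real.exp_le_one_iff.2 (by have := abs_nonneg (u / (2 * M)); linarith)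
    have h3 := neg_abs_le (u / (2 * M))
    calc _ ≤ 2 * M * (u / (2 * M)) := mul_le_mul_of_nonneg_left (by linarith) h2.le
      _ = u := by field_simp
  have hhigh : u ≤ 2 * M * (1 + Real.exp |u / (2 * M)| + |u / (2 * M)|) := by
    have h1 := Real.exp_pos |u / (2 * M)|
    have h3 := le_abs_self (u / (2 * M))
    calc u = 2 * M * (u / (2 * M)) := by field_simp
      _ ≤ _ := mul_le_mul_of_nonneg_left (by linarith) h2.le
  obtain ⟨s, hs⟩ := mem_range_of_exists_le_of_exists_ge hc ⟨_, hlow⟩ ⟨_, hhigh⟩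
  refine ⟨2 * M * (1 + Real.exp s), ?_, (hval s).trans hs⟩
  have := mul_pos h2 (Real.exp_pos s)
  simp only [Set.mem_Ioi]
  linarith

/-- The Schwarzschild radius `r(u) > 2M` as a function of the Regge-Wheeler coordinate:
the inverse of `tortoise M` on `(2M, ∞)`. -/
def radius (M u : ℝ) : ℝ := Function.invFunOn (tortoise M) (Set.Ioi (2 * M)) u

theorem two_mul_lt_radius {M : ℝ} (hM : 0 < M) (u : ℝ) : 2 * M < radius M u :=
  Function.invFunOn_mem (tortoise_surjOn hM u)

theorem tortoise_radius {M : ℝ} (hM : 0 < M) (u : ℝ) : tortoise M (radius M u) = u :=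
  Function.invFunOn_eq (tortoise_surjOn hM u)

/-- The potential `V₀(u) = (1 - 2M / r) 2M / r³`, `r = r(u)`, of the angular mode `l = 0`. -/
def potential (M u : ℝ) : ℝ := (1 - 2 * M / radius M u) * (2 * M / radius M u ^ 3)

/-- The iteration scheme of the Jost equation with boundary conditions at `-∞`. -/
def acuteIter (M : ℝ) (ω : ℂ) : ℕ → ℝ → ℂ
  | 0, u => Complex.exp (Complex.I * ω * u)
  | k + 1, u => ∫ v in Set.Iic u,
      1 / ω * Complex.sin (ω * (u - v)) * (potential M v : ℂ) * acuteIter M ω k v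

/-- The iteration scheme of the Jost equation with boundary conditions at `+∞`. -/
def graveIter (M : ℝ) (ω : ℂ) : ℕ → ℝ → ℂ
  | 0, u => Complex.exp (-(Complex.I * ω * u))
  | k + 1, u => -∫ v in Set.Ioi u,
      1 / ω * Complex.sin (ω * (u - v)) * (potential M v : ℂ) * graveIter M ω k v

/-- The Jost solution with `φ(u) ~ exp (iωu)` as `u → -∞`. -/
def acute (M : ℝ) (ω : ℂ) (u : ℝ) : ℂ := ∑' k, acuteIter M ω k u

/-- The Jost solution with `φ(u) ~ exp (-iωu)` as `u → +∞`. -/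
def grave (M : ℝ) (ω : ℂ) (u : ℝ) : ℂ := ∑' k, graveIter M ω k u

/-- The Schrödinger equation `(-∂ᵤ² - ω² + V₀(u)) φ(u) = 0`, for `C²` functions `φ` on `ℝ`. -/
def SolvesSchrodinger (M : ℝ) (ω : ℂ) (φ : ℝ → ℂ) : Prop :=
  ContDiff ℝ 2 φ ∧
    ∀ u : ℝ, -(deriv (deriv φ) u) + (-ω ^ 2 + (potential M u : ℂ)) * φ u = 0

/-- `φ` solves the Schrödinger equation, and `exp (-iωu) φ(u)` tends to `1` and its derivative
to `0` as `u → -∞`. -/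
def IsAcuteSolution (M : ℝ) (ω : ℂ) (φ : ℝ → ℂ) : Prop :=
  SolvesSchrodinger M ω φ ∧
    Filter.Tendsto (fun u : ℝ => Complex.exp (-(Complex.I * ω * u)) * φ u)
      Filter.atBot (nhds 1) ∧
    Filter.Tendsto (deriv fun u : ℝ => Complex.exp (-(Complex.I * ω * u)) * φ u)
      Filter.atBot (nhds 0)

/-- `φ` solves the Schrödinger equation, and `exp (iωu) φ(u)` tends to `1` and its derivative
to `0` as `u → +∞`. -/
def IsGraveSolution (M : ℝ) (ω : ℂ) (φ : ℝ → ℂ) : Prop :=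
  SolvesSchrodinger M ω φ ∧
    Filter.Tendsto (fun u : ℝ => Complex.exp (Complex.I * ω * u) * φ u)
      Filter.atTop (nhds 1) ∧
    Filter.Tendsto (deriv fun u : ℝ => Complex.exp (Complex.I * ω * u) * φ u)
      Filter.atTop (nhds 0)

/-- The Wronskian `f g' - f' g`. For two solutions of the same Schrödinger equation it does not
depend on the point `x`. -/
def wronskian (f g : ℝ → ℂ) (x : ℝ) : ℂ := f x * deriv g x - deriv f x * g x

/-- The kernel `Im (φ́_ω(u) φ̀_ω(v) / w(φ́_ω, φ̀_ω))`. The Wronskian is evaluated at `u`,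
which is immaterial. -/
def kernel (M ω u v : ℝ) : ℝ :=
  (acute M ω u * grave M ω v / wronskian (acute M ω) (grave M ω) u).im

/-- The `v`-integrand: the kernel times the matrix `(ω, 1; ω², ω)` applied to `Ψ₀(v)`. -/
def density (M u : ℝ) (Ψ₀ : ℝ → Fin 2 → ℂ) (ω v : ℝ) : Fin 2 → ℂ :=
  (kernel M ω u v : ℂ) •
    Matrix.mulVec !![(ω : ℂ), 1; (ω : ℂ) ^ 2, (ω : ℂ)] (Ψ₀ v)

/-- The integrand (without the factor `exp (-iωt)`) of the spectral representation,
as a function of `ω`. -/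
def spectralIntegrand (M u : ℝ) (Ψ₀ : ℝ → Fin 2 → ℂ) (ω : ℝ) : Fin 2 → ℂ :=
  ∫ v in tsupport Ψ₀, density M u Ψ₀ ω v

end Schwarzschild

end

/-!
The integrand is controlled by three facts about the Jost solutions at real frequencies `ω ≠ 0`:
they are smooth in `ω` with bounds that are uniform for `|ω| ≥ c > 0`, their Wronskian satisfies
`|w| ≥ 2|ω|`, and they solve the Schrödinger equation in the variable that is integrated against
the initial data.

*Smoothness in `ω`.* The potential decays only like `u⁻³`, so differentiating the Jost integral
equation four times in `ω` at fixed `u` would produce divergent integrals. Instead the equation on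
the half-line beginning at `v` is written in the coordinate `y = |ω| (x - v)`. The oscillating
factors then no longer depend on `ω`, and the rescaled potential is `ω⁻² V(v + y / |ω|)`. An
`ω`-derivative turns `V(v + s)` into `s V'(v + s)`, which decays as fast as `V` because
`V⁽ʲ⁾(t) = O((1 + |t|)^(-2-j))` (`isSymbol_potential`, proved by writing the derivatives of the
potential as polynomials in `1 / r`). Hence the rescaled potential, as an element of a weighted
space of bounded functions, is a smooth function of `ω` (`bddDeriv_coeff`). The Jost solution at
`v` is the value at `y = 0` of the resolvent of a Volterra operator which depends linearly on this
element (`jost_eq`). The powers of the operator have norms at most `(π‖q‖)ⁿ / n!`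
(`norm_volterraOp_pow_le`), so the resolvent exists for every `ω ≠ 0`, with locally uniform bounds,
and is smooth because inversion in a Banach algebra is. The derivative in `x` at `v` is a continuous
functional of the same data (`inv_mul_jostDeriv_eq`). Reflection `u ↦ -u` exchanges the two kinds
of Jost solutions.

*Wronskian.* The Wronskians of the solutions with their complex conjugates are `∓2iω`, by their
asymptotics. A Plücker identity then gives the lower bound (`two_mul_abs_le_norm_wronskian`).

*Decay.* The kernel `Im (φ́(u) φ̀(v) / w)` is a smooth solution in `v` on the whole line, hence
integration by parts gives `ω² ∫ K Ψ = ∫ K (-∂² + V₀) Ψ` without boundary terms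
(`pairing_schrodingerOp`). Iterating this turns the uniform bounds on the `ω`-derivatives of the
kernel into decay faster than any power of `ω` (`rapid_pairing`).
-/

namespace Schwarzschild

open Filter MeasureTheory Topology

/-! ### Families with uniformly bounded derivatives -/

section BddDeriv

variable {ι E F G R : Type*} [NormedAddCommGroup E] [NormedSpace ℝ E]
  [NormedAddCommGroup F] [NormedSpace ℝ F] [NormedAddCommGroup G] [NormedSpace ℝ G]
  [NormedRing R] [NormedAlgebra ℝ R]

/-- `BddDeriv S n f`: every member of the family `f` of functions of a real variable is `n` times
differentiable at the points of `S`, and the derivatives of order at most `n` are bounded on `S`,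
uniformly over the family. The derivative is carried along as a family in its own right, so that
closure properties can be proved by induction on `n`. -/
def BddDeriv (S : Set ℝ) : ℕ → (ι → ℝ → E) → Prop
  | 0, f => ∃ C, ∀ i, ∀ ω ∈ S, ‖f i ω‖ ≤ C
  | n + 1, f => (∃ C, ∀ i, ∀ ω ∈ S, ‖f i ω‖ ≤ C) ∧
      ∃ f' : ι → ℝ → E, (∀ i, ∀ ω ∈ S, HasDerivAt (f i) (f' i ω) ω) ∧ BddDeriv S n f'

namespace BddDeriv

variable {S : Set ℝ} {n : ℕ} {f g : ι → ℝ → E}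

theorem bound (h : BddDeriv S n f) : ∃ C, ∀ i, ∀ ω ∈ S, ‖f i ω‖ ≤ C := by
  cases n with
  | zero => exact h
  | succ n => exact h.1

theorem bound_nonneg (h : BddDeriv S n f) : ∃ C, 0 ≤ C ∧ ∀ i, ∀ ω ∈ S, ‖f i ω‖ ≤ C := by
  obtain ⟨C, hC⟩ := h.bound
  exact ⟨max C 0, le_max_right _ _, fun i ω hω => (hC i ω hω).trans (le_max_left _ _)⟩

theorem of_succ (h : BddDeriv S (n + 1) f) : BddDeriv S n f := by
  induction n generalizing f with
  | zero => exact h.1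
  | succ n ih =>
    obtain ⟨hb, f', hf', h'⟩ := h
    exact ⟨hb, f', hf', ih h'⟩

theorem congr (hS : IsOpen S) (h : BddDeriv S n f) (hfg : ∀ i, ∀ ω ∈ S, g i ω = f i ω) :
    BddDeriv S n g := by
  cases n with
  | zero =>
    obtain ⟨C, hC⟩ := h
    exact ⟨C, fun i ω hω => by rw [hfg i ω hω]; exact hC i ω hω⟩
  | succ n =>
    obtain ⟨⟨C, hC⟩, f', hf', h'⟩ := h
    refine ⟨⟨C, fun i ω hω => by rw [hfg i ω hω]; exact hC i ω hω⟩, f', fun i ω hω => ?_, h'⟩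
    refine (hf' i ω hω).congr_of_eventuallyEq ?_
    filter_upwards [hS.mem_nhds hω] with w hw using hfg i w hw

theorem zero : BddDeriv S n fun (_ : ι) (_ : ℝ) => (0 : E) := by
  induction n with
  | zero => exact ⟨0, by simp⟩
  | succ n ih => exact ⟨⟨0, by simp⟩, _, fun i ω _ => hasDerivAt_const ω 0, ih⟩

theorem const {a : ι → E} {C : ℝ} (ha : ∀ i, ‖a i‖ ≤ C) :
    BddDeriv S n fun i (_ : ℝ) => a i := by
  cases n with
  | zero => exact ⟨C, fun i _ _ => ha i⟩
  | succ n => exact ⟨⟨C, fun i _ _ => ha i⟩, _, fun i ω _ => hasDerivAt_const ω (a i), zero⟩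

theorem const' (a : E) : BddDeriv S n fun (_ : ι) (_ : ℝ) => a := const fun _ => le_rfl

theorem add (hf : BddDeriv S n f) (hg : BddDeriv S n g) :
    BddDeriv S n fun i ω => f i ω + g i ω := by
  induction n generalizing f g with
  | zero =>
    obtain ⟨C, hC⟩ := hf
    obtain ⟨D, hD⟩ := hg
    exact ⟨C + D, fun i ω hω => norm_add_le_of_le (hC i ω hω) (hD i ω hω)⟩
  | succ n ih =>
    obtain ⟨⟨C, hC⟩, f', hf', h'⟩ := hf
    obtain ⟨⟨D, hD⟩, g', hg', k'⟩ := hg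
    exact ⟨⟨C + D, fun i ω hω => norm_add_le_of_le (hC i ω hω) (hD i ω hω)⟩, _,
      fun i ω hω => (hf' i ω hω).add (hg' i ω hω), ih h' k'⟩

theorem clm (L : E →L[ℝ] F) (hf : BddDeriv S n f) : BddDeriv S n fun i ω => L (f i ω) := by
  have key : ∀ {f : ι → ℝ → E} {C : ℝ}, (∀ i, ∀ ω ∈ S, ‖f i ω‖ ≤ C) →
      ∀ i, ∀ ω ∈ S, ‖L (f i ω)‖ ≤ ‖L‖ * C := fun hC i ω hω =>
    (L.le_opNorm _).trans (mul_le_mul_of_nonneg_left (hC i ω hω) (norm_nonneg _))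
  induction n generalizing f with
  | zero =>
    obtain ⟨C, hC⟩ := hf
    exact ⟨_, key hC⟩
  | succ n ih =>
    obtain ⟨⟨C, hC⟩, f', hf', h'⟩ := hf
    exact ⟨⟨_, key hC⟩, _, fun i ω hω => L.hasFDerivAt.comp_hasDerivAt ω (hf' i ω hω), ih h'⟩

theorem neg (hf : BddDeriv S n f) : BddDeriv S n fun i ω => -f i ω :=
  hf.clm (-ContinuousLinearMap.id ℝ E)

theorem sub (hf : BddDeriv S n f) (hg : BddDeriv S n g) :
    BddDeriv S n fun i ω => f i ω - g i ω := by
  simpa only [sub_eq_add_neg] using hf.add hg.neg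

theorem bilin (B : E →L[ℝ] F →L[ℝ] G) {g : ι → ℝ → F} (hf : BddDeriv S n f)
    (hg : BddDeriv S n g) : BddDeriv S n fun i ω => B (f i ω) (g i ω) := by
  have key : ∀ {n : ℕ} {f : ι → ℝ → E} {g : ι → ℝ → F}, BddDeriv S n f → BddDeriv S n g →
      ∃ C, ∀ i, ∀ ω ∈ S, ‖B (f i ω) (g i ω)‖ ≤ C := by
    intro n f g hf hg
    obtain ⟨C, hC0, hC⟩ := hf.bound_nonneg
    obtain ⟨D, hD0, hD⟩ := hg.bound_nonneg
    exact ⟨‖B‖ * C * D, fun i ω hω => B.le_of_opNorm₂_le_of_le le_rfl (hC i ω hω) (hD i ω hω)⟩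
  induction n generalizing f g with
  | zero => exact key hf hg
  | succ n ih =>
    have hfn := hf.of_succ
    have hgn := hg.of_succ
    refine ⟨key hf hg, ?_⟩
    obtain ⟨-, f', hf', h'⟩ := hf
    obtain ⟨-, g', hg', k'⟩ := hg
    exact ⟨_, fun i ω hω => ContinuousLinearMap.hasDerivAt_of_bilinear (B := B)
      (fun _ => hf' i ω hω) (fun _ => hg' i ω hω), (ih hfn k').add (ih h' hgn)⟩

theorem mul {f g : ι → ℝ → R} (hf : BddDeriv S n f) (hg : BddDeriv S n g) :
    BddDeriv S n fun i ω => f i ω * g i ω :=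
  hf.bilin (ContinuousLinearMap.mul ℝ R) hg

theorem pow {f : ι → ℝ → R} (hf : BddDeriv S n f) (k : ℕ) :
    BddDeriv S n fun i ω => f i ω ^ k := by
  induction k with
  | zero => simpa using const' (1 : R)
  | succ k ih => simpa only [pow_succ] using ih.mul hf

/-- The inverse of a family in a Banach algebra belongs to the same class as soon as it is
bounded, since its derivative is `-f⁻¹ f' f⁻¹`. -/
theorem inverse [CompleteSpace R] (hS : IsOpen S) {f g : ι → ℝ → R} (hf : BddDeriv S n f)
    (hfg : ∀ i, ∀ ω ∈ S, f i ω * g i ω = 1) (hgf : ∀ i, ∀ ω ∈ S, g i ω * f i ω = 1) {C : ℝ}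
    (hC : ∀ i, ∀ ω ∈ S, ‖g i ω‖ ≤ C) : BddDeriv S n g := by
  induction n with
  | zero => exact ⟨C, hC⟩
  | succ n ih =>
    have hg := ih hf.of_succ
    obtain ⟨-, f', hf', h'⟩ := hf
    refine ⟨⟨C, hC⟩, fun i ω => -(g i ω * f' i ω * g i ω), fun i ω hω => ?_,
      ((hg.mul h').mul hg).neg⟩
    let U : Rˣ := ⟨f i ω, g i ω, hfg i ω hω, hgf i ω hω⟩
    have h1 := (hasFDerivAt_ringInverse (𝕜 := ℝ) U).comp_hasDerivAt ω (hf' i ω hω)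
    have h2 : g i =ᶠ[𝓝 ω] Ring.inverse ∘ f i := by
      filter_upwards [hS.mem_nhds hω] with w hw
      exact (Ring.inverse_unit (⟨f i w, g i w, hfg i w hw, hgf i w hw⟩ : Rˣ)).symm
    refine (h1.congr_of_eventuallyEq h2).congr_deriv ?_
    simp [U]

theorem inv {f : ι → ℝ → ℂ} (hS : IsOpen S) (hf : BddDeriv S n f) {c : ℝ} (hc : 0 < c)
    (h : ∀ i, ∀ ω ∈ S, c ≤ ‖f i ω‖) : BddDeriv S n fun i ω => (f i ω)⁻¹ := by
  have h0 : ∀ i, ∀ ω ∈ S, f i ω ≠ 0 := fun i ω hω =>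
    norm_pos_iff.1 (hc.trans_le (h i ω hω))
  refine hf.inverse hS (fun i ω hω => mul_inv_cancel₀ (h0 i ω hω))
    (fun i ω hω => inv_mul_cancel₀ (h0 i ω hω)) (C := c⁻¹) fun i ω hω => ?_
  rw [norm_inv]
  exact inv_anti₀ hc (h i ω hω)

theorem integral [CompleteSpace E] [MeasurableSpace ι] {μ : Measure ι} [IsFiniteMeasure μ]
    (hS : IsOpen S) (hf : BddDeriv S n f)
    (hm : ∀ ω ∈ S, AEStronglyMeasurable (fun i => f i ω) μ) :
    BddDeriv S n fun (_ : Unit) ω => ∫ i, f i ω ∂μ := by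
  have key : ∀ {f : ι → ℝ → E} {C : ℝ}, (∀ i, ∀ ω ∈ S, ‖f i ω‖ ≤ C) →
      ∀ _ : Unit, ∀ ω ∈ S, ‖∫ i, f i ω ∂μ‖ ≤ C * μ.real Set.univ := fun hC _ ω hω =>
    norm_integral_le_of_norm_le_const (Eventually.of_forall fun i => hC i ω hω)
  induction n generalizing f with
  | zero =>
    obtain ⟨C, hC⟩ := hf
    exact ⟨_, key hC⟩
  | succ n ih =>
    obtain ⟨⟨C, hC⟩, f', hf', h'⟩ := hf
    have hm' : ∀ ω ∈ S, AEStronglyMeasurable (fun i => f' i ω) μ := by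
      intro ω hω
      obtain ⟨ε, hε, hball⟩ := Metric.isOpen_iff.1 hS ω hω
      -- the derivative is a limit of difference quotients along a sequence inside `S`
      have hseq : Tendsto (fun k : ℕ => ε / 2 / (k + 1 : ℝ)) atTop (𝓝 0) := by
        have := (tendsto_one_div_add_atTop_nhds_zero_nat (𝕜 := ℝ)).const_mul (ε / 2)
        simpa [div_eq_mul_inv] using this
      have hpos : ∀ k : ℕ, 0 < ε / 2 / (k + 1 : ℝ) := fun k => by positivity
      have hle : ∀ k : ℕ, ε / 2 / (k + 1 : ℝ) < ε := fun k => by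
        have : ε / 2 / (k + 1 : ℝ) ≤ ε / 2 := div_le_self (by positivity) (by
          have : (0 : ℝ) ≤ k := Nat.cast_nonneg k
          linarith)
        linarith
      have hseq' : Tendsto (fun k : ℕ => ε / 2 / (k + 1 : ℝ)) atTop (𝓝[≠] 0) :=
        tendsto_nhdsWithin_iff.2 ⟨hseq, Eventually.of_forall fun k => (hpos k).ne'⟩
      refine aestronglyMeasurable_of_tendsto_ae atTop
        (f := fun (k : ℕ) i =>
          (ε / 2 / (k + 1 : ℝ))⁻¹ • (f i (ω + ε / 2 / (k + 1 : ℝ)) - f i ω)) (fun k => ?_)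
        (Eventually.of_forall fun i =>
          (hasDerivAt_iff_tendsto_slope_zero.1 (hf' i ω hω)).comp hseq')
      refine ((hm _ (hball ?_)).sub (hm ω hω)).const_smul _
      rw [Metric.mem_ball, Real.dist_eq, add_sub_cancel_left, abs_of_pos (hpos k)]
      exact hle k
    refine ⟨⟨_, key hC⟩, fun _ ω => ∫ i, f' i ω ∂μ, fun _ ω hω => ?_, ih h' hm'⟩
    obtain ⟨D, hD⟩ := h'.bound
    refine (hasDerivAt_integral_of_dominated_loc_of_deriv_le (bound := fun _ => D)
      (F := fun w i => f i w) (F' := fun w i => f' i w)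
      (hS.mem_nhds hω) ?_ ?_ (hm' ω hω) ?_ (integrable_const D) ?_).2
    · filter_upwards [hS.mem_nhds hω] with w hw using hm w hw
    · exact Integrable.of_bound (hm ω hω) C (Eventually.of_forall fun i => hC i ω hω)
    · exact Eventually.of_forall fun i w hw => hD i w hw
    · exact Eventually.of_forall fun i w hw => hf' i w hw

theorem contDiffOn (hS : IsOpen S) (hf : BddDeriv S (n + 1) f) (i : ι) :
    ContDiffOn ℝ n (f i) S := by
  induction n generalizing f with
  | zero =>
    obtain ⟨-, f', hf', -⟩ := hf
    exact contDiffOn_zero.2 fun ω hω => (hf' i ω hω).continuousAt.continuousWithinAt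
  | succ n ih =>
    obtain ⟨-, f', hf', h'⟩ := hf
    push_cast
    refine (contDiffOn_succ_iff_deriv_of_isOpen hS).2
      ⟨fun ω hω => (hf' i ω hω).differentiableAt.differentiableWithinAt, by simp, ?_⟩
    exact (ih h').congr fun ω hω => (hf' i ω hω).deriv

theorem deriv (hS : IsOpen S) (hf : BddDeriv S (n + 1) f) :
    BddDeriv S n fun i => deriv (f i) := by
  obtain ⟨-, f', hf', h'⟩ := hf
  exact h'.congr hS fun i ω hω => (hf' i ω hω).deriv

theorem hasDerivAt_deriv (hf : BddDeriv S (n + 1) f) (i : ι) {ω : ℝ} (hω : ω ∈ S) :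
    HasDerivAt (f i) (_root_.deriv (f i) ω) ω := by
  obtain ⟨-, f', hf', -⟩ := hf
  exact (hf' i ω hω).differentiableAt.hasDerivAt

end BddDeriv

/-- In a space of bounded functions, pointwise derivatives are derivatives for the sup norm if the
pointwise second derivatives are uniformly bounded. -/
theorem hasDerivAt_boundedContinuousFunction {α : Type*} [TopologicalSpace α] {S : Set ℝ}
    (hS : IsOpen S) {f f₁ f₂ : ℝ → BoundedContinuousFunction α E} {C : ℝ}
    (h1 : ∀ ω ∈ S, ∀ y, HasDerivAt (fun w => f w y) (f₁ ω y) ω)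
    (h2 : ∀ ω ∈ S, ∀ y, HasDerivAt (fun w => f₁ w y) (f₂ ω y) ω)
    (hC : ∀ ω ∈ S, ‖f₂ ω‖ ≤ C) {ω : ℝ} (hω : ω ∈ S) : HasDerivAt f (f₁ ω) ω := by
  have hC0 : 0 ≤ C := (norm_nonneg _).trans (hC ω hω)
  obtain ⟨ε, hε, hball⟩ := Metric.isOpen_iff.1 hS ω hω
  have hω' : ω ∈ Metric.ball ω ε := Metric.mem_ball_self hε
  have hb1 : ∀ w ∈ Metric.ball ω ε, ∀ y, ‖f₁ w y - f₁ ω y‖ ≤ C * ‖w - ω‖ := fun w hw y =>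
    (convex_ball ω ε).norm_image_sub_le_of_norm_hasDerivWithin_le
      (fun x hx => (h2 x (hball hx) y).hasDerivWithinAt)
      (fun x hx => ((f₂ x).norm_coe_le_norm y).trans (hC x (hball hx))) hω' hw
  have hb2 : ∀ w ∈ Metric.ball ω ε, ∀ y,
      ‖f w y - f ω y - (w - ω) • f₁ ω y‖ ≤ C * ‖w - ω‖ ^ 2 := by
    intro w hw y
    have hsub : ∀ x ∈ Metric.closedBall ω ‖w - ω‖, x ∈ Metric.ball ω ε := fun x hx =>
      Metric.mem_ball.2 (lt_of_le_of_lt (Metric.mem_closedBall.1 hx) (by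
        simpa [dist_eq_norm] using Metric.mem_ball.1 hw))
    have := (convex_closedBall ω ‖w - ω‖).norm_image_sub_le_of_norm_hasDerivWithin_le
      (f := fun x => f x y - (x - ω) • f₁ ω y) (f' := fun x => f₁ x y - (1 : ℝ) • f₁ ω y)
      (C := C * ‖w - ω‖) (x := ω) (y := w)
      (fun x hx => ((h1 x (hball (hsub x hx)) y).sub
        (((hasDerivAt_id x).sub_const ω).smul_const (f₁ ω y))).hasDerivWithinAt)
      (fun x hx => by
        rw [one_smul]
        exact (hb1 x (hsub x hx) y).trans (mul_le_mul_of_nonneg_left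
          (by simpa [dist_eq_norm] using hx) hC0))
      (by simp) (by simp [dist_eq_norm])
    simp only [sub_self, zero_smul, sub_zero] at this
    calc _ = ‖f w y - (w - ω) • f₁ ω y - f ω y‖ := by congr 1; abel
      _ ≤ _ := this
      _ = _ := by ring
  rw [hasDerivAt_iff_isLittleO]
  refine Asymptotics.IsBigO.trans_isLittleO (g := fun w => ‖w - ω‖ ^ 2) ?_ ?_
  · refine Asymptotics.IsBigO.of_bound C ?_
    filter_upwards [Metric.ball_mem_nhds ω hε] with w hw
    rw [norm_pow, norm_norm]
    refine (BoundedContinuousFunction.norm_le (by positivity)).2 fun y => ?_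
    simpa using hb2 w hw y
  · simpa using Asymptotics.isLittleO_pow_sub_sub ω (m := 2) (by norm_num)

end BddDeriv

/-! ### The Volterra operator on bounded continuous functions -/

section Volterra

/-- Bounded continuous functions on the line, with the sup norm. -/
abbrev BC : Type := BoundedContinuousFunction ℝ ℂ

/-- The Volterra kernel `sin (y - x) / (1 + y²)` for `y > x`, and `0` for `y ≤ x`. -/
noncomputable def volterraKernel (x y : ℝ) : ℝ := Real.sin (max (y - x) 0) * (1 + y ^ 2)⁻¹

theorem volterraKernel_of_le {x y : ℝ} (h : y ≤ x) : volterraKernel x y = 0 := by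
  simp [volterraKernel, max_eq_right (sub_nonpos.2 h)]

theorem abs_volterraKernel_le (x y : ℝ) : |volterraKernel x y| ≤ (1 + y ^ 2)⁻¹ := by
  rw [volterraKernel, abs_mul, abs_of_nonneg (a := (1 + y ^ 2)⁻¹) (by positivity)]
  exact mul_le_of_le_one_left (by positivity) (Real.abs_sin_le_one _)

theorem continuous_weight : Continuous fun y : ℝ => (1 + y ^ 2)⁻¹ :=
  (by fun_prop : Continuous fun y : ℝ => 1 + y ^ 2).inv₀ fun y => by positivity

theorem continuous_volterraKernel : Continuous fun p : ℝ × ℝ => volterraKernel p.1 p.2 := by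
  have := continuous_weight.comp (continuous_snd (X := ℝ) (Y := ℝ))
  exact (by fun_prop : Continuous fun p : ℝ × ℝ => Real.sin (max (p.2 - p.1) 0)).mul this

theorem norm_volterraKernel_mul_le (g : BC) (x y : ℝ) :
    ‖(volterraKernel x y : ℂ) * g y‖ ≤ (1 + y ^ 2)⁻¹ * ‖g‖ := by
  rw [norm_mul, Complex.norm_real, Real.norm_eq_abs]
  exact mul_le_mul (abs_volterraKernel_le x y) (g.norm_coe_le_norm y) (norm_nonneg _)
    (by positivity)

theorem continuous_volterraKernel_mul (g : BC) (x : ℝ) :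
    Continuous fun y => (volterraKernel x y : ℂ) * g y :=
  (Complex.continuous_ofReal.comp
    (continuous_volterraKernel.comp (Continuous.prodMk_right x))).mul g.continuous

theorem integrable_volterraKernel_mul (g : BC) (x : ℝ) :
    Integrable fun y => (volterraKernel x y : ℂ) * g y :=
  (integrable_inv_one_add_sq.mul_const ‖g‖).mono'
    (continuous_volterraKernel_mul g x).aestronglyMeasurable
    (Eventually.of_forall fun y => norm_volterraKernel_mul_le g x y)

/-- The integral operator with kernel `volterraKernel`, on bounded continuous functions. -/
noncomputable def volterra : BC →L[ℝ] BC :=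
  LinearMap.mkContinuous
    { toFun := fun g => BoundedContinuousFunction.ofNormedAddCommGroup
        (fun x => ∫ y, (volterraKernel x y : ℂ) * g y)
        (continuous_of_dominated
          (fun x => (continuous_volterraKernel_mul g x).aestronglyMeasurable)
          (fun x => Eventually.of_forall fun y => norm_volterraKernel_mul_le g x y)
          (integrable_inv_one_add_sq.mul_const ‖g‖)
          (Eventually.of_forall fun y => (Complex.continuous_ofReal.comp
            (continuous_volterraKernel.comp (Continuous.prodMk_left y))).mul continuous_const))
        (Real.pi * ‖g‖) fun x => by
          refine (norm_integral_le_of_norm_le (integrable_inv_one_add_sq.mul_const ‖g‖)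
            (Eventually.of_forall fun y => norm_volterraKernel_mul_le g x y)).trans ?_
          rw [integral_mul_const, integral_univ_inv_one_add_sq]
      map_add' := fun f g => by
        ext x
        simp only [BoundedContinuousFunction.coe_ofNormedAddCommGroup,
          BoundedContinuousFunction.coe_add, Pi.add_apply, mul_add]
        exact integral_add (integrable_volterraKernel_mul f x) (integrable_volterraKernel_mul g x)
      map_smul' := fun c g => by
        ext x
        simp only [BoundedContinuousFunction.coe_ofNormedAddCommGroup,
          BoundedContinuousFunction.coe_smul, mul_smul_comm, RingHom.id_apply]
        exact integral_smul c _ }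
    Real.pi fun g =>
      BoundedContinuousFunction.norm_ofNormedAddCommGroup_le _ (by positivity) fun x => by
        refine (norm_integral_le_of_norm_le (integrable_inv_one_add_sq.mul_const ‖g‖)
          (Eventually.of_forall fun y => norm_volterraKernel_mul_le g x y)).trans ?_
        rw [integral_mul_const, integral_univ_inv_one_add_sq]

theorem volterra_apply (g : BC) (x : ℝ) :
    volterra g x = ∫ y, (volterraKernel x y : ℂ) * g y := rfl

/-- The tail `∫_x^∞ dy / (1 + y²)` of the weight. -/
noncomputable def tail (x : ℝ) : ℝ := Real.pi / 2 - Real.arctan x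

theorem tail_nonneg (x : ℝ) : 0 ≤ tail x := by
  have := Real.arctan_lt_pi_div_two x
  simp only [tail]
  linarith

theorem tail_le_pi (x : ℝ) : tail x ≤ Real.pi := by
  have := Real.neg_pi_div_two_lt_arctan x
  simp only [tail]
  linarith

theorem integrable_tail_pow (n : ℕ) : Integrable fun y => (1 + y ^ 2)⁻¹ * tail y ^ n := by
  have hc : Continuous tail := continuous_const.sub Real.continuous_arctan
  refine (integrable_inv_one_add_sq.mul_const (Real.pi ^ n)).mono'
    (continuous_weight.mul (hc.pow n)).aestronglyMeasurable (Eventually.of_forall fun y => ?_)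
  have := tail_nonneg y
  rw [Real.norm_of_nonneg (by positivity)]
  gcongr
  exact tail_le_pi y

theorem integral_Ioi_tail_pow (n : ℕ) (x : ℝ) :
    ∫ y in Set.Ioi x, (1 + y ^ 2)⁻¹ * tail y ^ n = tail x ^ (n + 1) / (n + 1) := by
  have hd : ∀ y, HasDerivAt (fun y => -(tail y ^ (n + 1) / (n + 1)))
      ((1 + y ^ 2)⁻¹ * tail y ^ n) y := by
    intro y
    have h := ((((Real.hasDerivAt_arctan y).const_sub (Real.pi / 2)).pow (n + 1)).div_const
      ((n : ℝ) + 1)).neg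
    refine h.congr_deriv ?_
    have : (n : ℝ) + 1 ≠ 0 := by positivity
    simp only [tail]
    push_cast
    field_simp
  have ht : Tendsto (fun y => -(tail y ^ (n + 1) / (n + 1))) atTop (𝓝 0) := by
    have h0 : Tendsto tail atTop (𝓝 0) := by
      have := (tendsto_nhds_of_tendsto_nhdsWithin Real.tendsto_arctan_atTop).const_sub
        (Real.pi / 2)
      rw [sub_self] at this
      exact this
    have := ((h0.pow (n + 1)).div_const ((n : ℝ) + 1)).neg
    simpa using this
  rw [integral_Ioi_of_hasDerivAt_of_tendsto (hd x).continuousAt.continuousWithinAt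
    (fun y _ => hd y) (integrable_tail_pow n).integrableOn ht]
  ring

/-- The gain of the Volterra structure: each application of the operator to a function bounded by
`tail ^ n / n!` raises `n` by one. -/
theorem norm_volterra_apply_le {g : BC} {K : ℝ} {n : ℕ}
    (hg : ∀ y, ‖g y‖ ≤ K * (tail y ^ n / n.factorial)) (x : ℝ) :
    ‖volterra g x‖ ≤ K * (tail x ^ (n + 1) / (n + 1).factorial) := by
  rw [volterra_apply, ← setIntegral_eq_integral_of_forall_compl_eq_zero (s := Set.Ioi x)
    fun y hy => by rw [volterraKernel_of_le (not_lt.1 hy)]; simp]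
  refine (norm_integral_le_of_norm_le
    (((integrable_tail_pow n).const_mul (K / n.factorial)).integrableOn)
    (Eventually.of_forall fun y => ?_)).trans_eq ?_
  · rw [norm_mul, Complex.norm_real, Real.norm_eq_abs]
    calc _ ≤ (1 + y ^ 2)⁻¹ * (K * (tail y ^ n / n.factorial)) :=
          mul_le_mul (abs_volterraKernel_le x y) (hg y) (norm_nonneg _) (by positivity)
      _ = _ := by ring
  · rw [integral_const_mul, integral_Ioi_tail_pow, Nat.factorial_succ]
    push_cast
    field_simp

/-- The operator `f ↦ ∫ volterraKernel x y q y f y dy`. -/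
noncomputable def volterraOp (q : BC) : BC →L[ℝ] BC := volterra ∘L ContinuousLinearMap.mul ℝ BC q

theorem volterraOp_apply (q f : BC) (x : ℝ) :
    volterraOp q f x = ∫ y, (volterraKernel x y : ℂ) * (q y * f y) := rfl

theorem norm_volterraOp_pow_apply_le (q f : BC) (n : ℕ) (x : ℝ) :
    ‖(volterraOp q ^ n) f x‖ ≤ ‖f‖ * ‖q‖ ^ n * (tail x ^ n / n.factorial) := by
  induction n generalizing x with
  | zero => simpa using f.norm_coe_le_norm x
  | succ n ih =>
    rw [pow_succ']
    refine norm_volterra_apply_le (fun y => ?_) x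
    change ‖q y * (volterraOp q ^ n) f y‖ ≤ _
    rw [norm_mul]
    calc _ ≤ ‖q‖ * (‖f‖ * ‖q‖ ^ n * (tail y ^ n / n.factorial)) :=
          mul_le_mul (q.norm_coe_le_norm y) (ih y) (norm_nonneg _) (norm_nonneg _)
      _ = _ := by ring

theorem norm_volterraOp_pow_le (q : BC) (n : ℕ) :
    ‖volterraOp q ^ n‖ ≤ (Real.pi * ‖q‖) ^ n / n.factorial := by
  refine ContinuousLinearMap.opNorm_le_bound _ (by positivity) fun f => ?_
  refine (BoundedContinuousFunction.norm_le (by positivity)).2 fun x => ?_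
  refine (norm_volterraOp_pow_apply_le q f n x).trans ?_
  calc _ ≤ ‖f‖ * ‖q‖ ^ n * (Real.pi ^ n / n.factorial) := by
        have := tail_nonneg x
        gcongr
        exact tail_le_pi x
    _ = _ := by rw [mul_pow]; ring

theorem summable_norm_volterraOp_pow (q : BC) : Summable fun n => ‖volterraOp q ^ n‖ :=
  (Real.summable_pow_div_factorial (Real.pi * ‖q‖)).of_nonneg_of_le (fun _ => norm_nonneg _)
    (norm_volterraOp_pow_le q)

/-- The Neumann series of `(1 - volterraOp q)⁻¹`, convergent for every `q`. -/
noncomputable def resolvent (q : BC) : BC →L[ℝ] BC := ∑' n, volterraOp q ^ n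

theorem hasSum_resolvent (q : BC) : HasSum (fun n => volterraOp q ^ n) (resolvent q) :=
  (summable_norm_volterraOp_pow q).of_norm.hasSum

theorem one_sub_mul_resolvent (q : BC) : (1 - volterraOp q) * resolvent q = 1 :=
  (summable_norm_volterraOp_pow q).of_norm.one_sub_mul_tsum_pow

theorem resolvent_mul_one_sub (q : BC) : resolvent q * (1 - volterraOp q) = 1 :=
  (summable_norm_volterraOp_pow q).of_norm.tsum_pow_mul_one_sub

theorem norm_resolvent_le (q : BC) : ‖resolvent q‖ ≤ Real.exp (Real.pi * ‖q‖) := by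
  rw [Real.exp_eq_exp_ℝ, NormedSpace.exp_eq_tsum_div]
  exact tsum_of_norm_bounded (Real.summable_pow_div_factorial _).hasSum (norm_volterraOp_pow_le q)

theorem hasSum_resolvent_apply (q f : BC) (x : ℝ) :
    HasSum (fun n => (volterraOp q ^ n) f x) (resolvent q f x) := by
  have h1 := (ContinuousLinearMap.apply ℝ BC f).hasSum (hasSum_resolvent q)
  exact (BoundedContinuousFunction.evalCLM ℝ x).hasSum h1

theorem resolvent_apply_eq (q f : BC) : resolvent q f = f + volterraOp q (resolvent q f) := by
  have h := DFunLike.congr_fun (one_sub_mul_resolvent q) f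
  simp only [mul_apply_eq_comp, sub_apply, one_apply_eq_self] at h
  exact sub_eq_iff_eq_add.1 h

/-- The resolvent of a uniformly bounded family depends on a parameter as regularly as the
coefficient `q`. -/
theorem BddDeriv.resolvent {ι : Type*} {S : Set ℝ} (hS : IsOpen S) {n : ℕ} {q : ι → ℝ → BC}
    (hq : BddDeriv S n q) : BddDeriv S n fun i ω => Schwarzschild.resolvent (q i ω) := by
  have hop : BddDeriv S n fun i ω => volterraOp (q i ω) :=
    hq.clm ((ContinuousLinearMap.compL ℝ BC BC BC volterra) ∘L ContinuousLinearMap.mul ℝ BC)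
  obtain ⟨C, hC⟩ := hq.bound
  refine ((const' (1 : BC →L[ℝ] BC)).sub hop).inverse hS
    (g := fun i ω => Schwarzschild.resolvent (q i ω))
    (fun i ω _ => one_sub_mul_resolvent _) (fun i ω _ => resolvent_mul_one_sub _)
    (C := Real.exp (Real.pi * C)) fun i ω hω => (norm_resolvent_le _).trans ?_
  have := hC i ω hω
  gcongr

end Volterra

/-! ### Symbol estimates and the rescaled potential -/

section Symbol

/-- Smooth potentials `V` all of whose derivatives satisfy `|V⁽ʲ⁾(t)| ≤ C (1 + |t|)^(-2-j)`. -/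
structure IsSymbol (V : ℝ → ℝ) : Prop where
  contDiff : ContDiff ℝ ((⊤ : ℕ∞) : WithTop ℕ∞) V
  bound : ∀ j : ℕ, ∃ C, ∀ t, (1 + |t|) ^ (j + 2) * |iteratedDeriv j V t| ≤ C

variable {V : ℝ → ℝ}

theorem IsSymbol.comp_neg (hV : IsSymbol V) : IsSymbol fun t => V (-t) where
  contDiff := hV.contDiff.comp contDiff_neg
  bound := fun j => by
    obtain ⟨C, hC⟩ := hV.bound j
    refine ⟨C, fun t => ?_⟩
    have := hC (-t)
    rw [abs_neg] at this
    rw [iteratedDeriv_comp_neg, smul_eq_mul, abs_mul, abs_pow, abs_neg, abs_one, one_pow, one_mul]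
    exact this

theorem IsSymbol.continuous_iteratedDeriv (hV : IsSymbol V) (j : ℕ) :
    Continuous (iteratedDeriv j V) :=
  hV.contDiff.continuous_iteratedDeriv j (by exact_mod_cast le_top)

theorem IsSymbol.hasDerivAt_iteratedDeriv (hV : IsSymbol V) (j : ℕ) (t : ℝ) :
    HasDerivAt (iteratedDeriv j V) (iteratedDeriv (j + 1) V t) t := by
  rw [iteratedDeriv_succ]
  exact (hV.contDiff.differentiable_iteratedDeriv j (by exact_mod_cast WithTop.coe_lt_top j)
    t).hasDerivAt

theorem IsSymbol.integrable (hV : IsSymbol V) : Integrable V := by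
  obtain ⟨C, hC⟩ := hV.bound 0
  refine (integrable_inv_one_add_sq.const_mul C).mono' hV.contDiff.continuous.aestronglyMeasurable
    (Eventually.of_forall fun t => ?_)
  have h := hC t
  rw [iteratedDeriv_zero, zero_add] at h
  rw [Real.norm_eq_abs, ← div_eq_mul_inv, le_div_iff₀ (by positivity), mul_comm]
  refine le_trans (mul_le_mul_of_nonneg_right ?_ (abs_nonneg _)) h
  nlinarith [abs_nonneg t, sq_abs t]

/-- The function `y ↦ (1 + y²) ω^(-k-2) sʲ V⁽ʲ⁾(v + s)` with `s = y / |ω|`. For `k = j = 0` it is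
`(1 + y²)` times the potential in the coordinate `y = |ω| (x - v)`. The other values of
`k` and `j` occur in its derivatives with respect to `ω`. -/
noncomputable def coeffFun (V : ℝ → ℝ) (k j : ℕ) (v ω y : ℝ) : ℝ :=
  (1 + y ^ 2) * (ω⁻¹ ^ (k + 2) * ((y / |ω|) ^ j * iteratedDeriv j V (v + y / |ω|)))

theorem continuous_coeffFun (hV : IsSymbol V) (k j : ℕ) (v ω : ℝ) :
    Continuous (coeffFun V k j v ω) := by
  have := (hV.continuous_iteratedDeriv j).comp
    (by fun_prop : Continuous fun y : ℝ => v + y / |ω|)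
  exact (by fun_prop : Continuous fun y : ℝ => 1 + y ^ 2).mul
    (continuous_const.mul ((by fun_prop : Continuous fun y : ℝ => (y / |ω|) ^ j).mul this))

/-- Rescaling costs no decay: the weight `1 + y²` and the factors `s` are absorbed by the decay
of the derivatives of the potential. -/
theorem abs_coeffFun_le {j : ℕ} {C : ℝ} (hC : ∀ t, (1 + |t|) ^ (j + 2) * |iteratedDeriv j V t| ≤ C)
    (k : ℕ) (v ω y : ℝ) :
    |coeffFun V k j v ω y| ≤ |ω|⁻¹ ^ k * (1 + |ω|⁻¹ ^ 2) * ((1 + |v|) ^ (j + 2) * C) := by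
  have hC0 : 0 ≤ C := le_trans (by positivity) (hC 0)
  -- at `ω = 0` the function vanishes, since `0⁻¹ = 0`
  rcases eq_or_ne ω 0 with rfl | hω
  · simp only [coeffFun, inv_zero, ne_eq, Nat.add_eq_zero_iff, OfNat.ofNat_ne_zero, and_false,
      not_false_eq_true, zero_pow, zero_mul, mul_zero, abs_zero]
    positivity
  have ha : 0 < |ω| := abs_pos.2 hω
  set s := y / |ω| with hs
  have hy : y = |ω| * s := by rw [hs]; field_simp
  -- a shift by the bounded amount `v` changes the weights by a bounded factor only
  have h1 : (1 + |s|) ≤ (1 + |v|) * (1 + |v + s|) := by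
    have : |s| ≤ |v + s| + |v| := by
      calc |s| = |(v + s) - v| := by ring_nf
        _ ≤ _ := abs_sub _ _
    nlinarith [abs_nonneg v, abs_nonneg (v + s)]
  have h2 : (1 + |s|) ^ (j + 2) * |iteratedDeriv j V (v + s)| ≤ (1 + |v|) ^ (j + 2) * C := by
    calc _ ≤ ((1 + |v|) * (1 + |v + s|)) ^ (j + 2) * |iteratedDeriv j V (v + s)| := by gcongr
      _ = (1 + |v|) ^ (j + 2) * ((1 + |v + s|) ^ (j + 2) * |iteratedDeriv j V (v + s)|) := by
          rw [mul_pow]; ring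
      _ ≤ _ := by gcongr; exact hC _
  have h3 : (1 + y ^ 2) * |ω|⁻¹ ^ 2 ≤ (1 + |ω|⁻¹ ^ 2) * (1 + |s|) ^ 2 := by
    have e : (1 + y ^ 2) * |ω|⁻¹ ^ 2 = |ω|⁻¹ ^ 2 + |s| ^ 2 := by
      rw [hy, sq_abs]
      field_simp
    rw [e]
    nlinarith [abs_nonneg s, sq_nonneg (|ω|⁻¹), mul_nonneg (sq_nonneg (|ω|⁻¹)) (abs_nonneg s),
      mul_nonneg (sq_nonneg (|ω|⁻¹)) (sq_nonneg (|s|))]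
  calc |coeffFun V k j v ω y|
      = |ω|⁻¹ ^ k * ((1 + y ^ 2) * |ω|⁻¹ ^ 2) * (|s| ^ j * |iteratedDeriv j V (v + s)|) := by
        rw [coeffFun, abs_mul, abs_mul, abs_mul, abs_pow, abs_pow, abs_inv,
          abs_of_nonneg (a := 1 + y ^ 2) (by positivity)]
        ring
    _ ≤ |ω|⁻¹ ^ k * ((1 + |ω|⁻¹ ^ 2) * (1 + |s|) ^ 2) *
        ((1 + |s|) ^ j * |iteratedDeriv j V (v + s)|) := by
        gcongr
        linarith
    _ = |ω|⁻¹ ^ k * (1 + |ω|⁻¹ ^ 2) * ((1 + |s|) ^ (j + 2) * |iteratedDeriv j V (v + s)|) := by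
        ring
    _ ≤ _ := by gcongr

/-- The functions `coeffFun V k j v` are closed under differentiation with respect to `ω`. -/
theorem hasDerivAt_coeffFun (hV : IsSymbol V) (k j : ℕ) (v : ℝ) {ω : ℝ} (hω : ω ≠ 0) (y : ℝ) :
    HasDerivAt (fun w => coeffFun V k j v w y)
      (-((k + 2 + j : ℕ) : ℝ) * coeffFun V (k + 1) j v ω y - coeffFun V (k + 1) (j + 1) v ω y)
      ω := by
  have habs : |ω| ≠ 0 := abs_ne_zero.2 hω
  have h1 : HasDerivAt (fun w : ℝ => |w|) (|ω| / ω) ω := by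
    refine (hasDerivAt_abs hω).congr_deriv ?_
    rcases lt_or_gt_of_ne hω with h | h
    · simp [h, abs_of_neg h, neg_div, div_self hω]
    · simp [h, abs_of_pos h, div_self hω]
  have h2 : HasDerivAt (fun w : ℝ => y / |w|) (-(y / |ω|) * ω⁻¹) ω := by
    refine ((hasDerivAt_const ω y).div h1 habs).congr_deriv ?_
    field_simp
    simp
  have h3 := (hV.hasDerivAt_iteratedDeriv j (v + y / |ω|)).comp ω (h2.const_add v)
  have h4 := ((hasDerivAt_inv hω).pow (k + 2)).mul ((h2.pow j).mul h3)
  refine (h4.const_mul (1 + y ^ 2)).congr_deriv ?_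
  -- for `j = 0` the truncated exponent `j - 1` is harmless because of the factor `j`
  have hj : (j : ℝ) * (y / |ω|) ^ (j - 1) * (y / |ω|) = j * (y / |ω|) ^ j := by
    cases j with
    | zero => simp
    | succ j => rw [Nat.add_sub_cancel, pow_succ]; ring
  simp only [coeffFun, Function.comp_apply, Pi.pow_apply, Pi.mul_apply, Nat.add_succ_sub_one]
  have e : -(ω ^ 2)⁻¹ = -(ω⁻¹ * ω⁻¹) := by rw [← mul_inv, sq]
  rw [e]
  generalize iteratedDeriv j V (v + y / |ω|) = D0
  generalize iteratedDeriv (j + 1) V (v + y / |ω|) = D1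
  generalize y / |ω| = s at *
  push_cast
  linear_combination (-(1 + y ^ 2) * ω⁻¹ ^ (k + 3) * D0) * hj

/-- `coeffFun` as an element of the space of bounded continuous functions. -/
noncomputable def coeff (hV : IsSymbol V) (k j : ℕ) (v ω : ℝ) : BC :=
  BoundedContinuousFunction.ofNormedAddCommGroup (fun y => (coeffFun V k j v ω y : ℂ))
    (Complex.continuous_ofReal.comp (continuous_coeffFun hV k j v ω))
    (|ω|⁻¹ ^ k * (1 + |ω|⁻¹ ^ 2) * ((1 + |v|) ^ (j + 2) * (hV.bound j).choose)) fun y => by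
      rw [Complex.norm_real, Real.norm_eq_abs]
      exact abs_coeffFun_le (hV.bound j).choose_spec k v ω y

theorem coeff_apply (hV : IsSymbol V) (k j : ℕ) (v ω y : ℝ) :
    coeff hV k j v ω y = (coeffFun V k j v ω y : ℂ) := rfl

theorem isOpen_lt_abs (c : ℝ) : IsOpen {ω : ℝ | c < |ω|} :=
  isOpen_lt continuous_const continuous_abs

theorem exists_norm_coeff_le (hV : IsSymbol V) (k j : ℕ) {ι : Type*} {v : ι → ℝ} {B : ℝ}
    (hv : ∀ i, |v i| ≤ B) {c : ℝ} (hc : 0 < c) :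
    ∃ C, ∀ i, ∀ ω ∈ {ω : ℝ | c < |ω|}, ‖coeff hV k j (v i) ω‖ ≤ C := by
  obtain ⟨C, hC⟩ := hV.bound j
  have hC0 : 0 ≤ C := le_trans (by positivity) (hC 0)
  refine ⟨c⁻¹ ^ k * (1 + c⁻¹ ^ 2) * ((1 + B) ^ (j + 2) * C), fun i ω hω => ?_⟩
  have hle : |ω|⁻¹ ≤ c⁻¹ := inv_anti₀ hc (le_of_lt hω)
  have hB : 0 ≤ B := (abs_nonneg _).trans (hv i)
  refine (BoundedContinuousFunction.norm_le (by positivity)).2 fun y => ?_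
  rw [coeff_apply, Complex.norm_real, Real.norm_eq_abs]
  refine (abs_coeffFun_le hC k (v i) ω y).trans ?_
  have := hv i
  gcongr

theorem hasDerivAt_coeff (hV : IsSymbol V) (k j : ℕ) (v : ℝ) {ω : ℝ} (hω : ω ≠ 0) :
    HasDerivAt (coeff hV k j v)
      (-((k + 2 + j : ℕ) : ℝ) • coeff hV (k + 1) j v ω - coeff hV (k + 1) (j + 1) v ω) ω := by
  have hc : 0 < |ω| / 2 := half_pos (abs_pos.2 hω)
  have h0 : ∀ w ∈ {w : ℝ | |ω| / 2 < |w|}, w ≠ 0 := fun w hw =>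
    abs_pos.1 (hc.trans hw)
  have key : ∀ k j : ℕ, ∀ w ∈ {w : ℝ | |ω| / 2 < |w|}, ∀ y,
      HasDerivAt (fun w => coeff hV k j v w y)
        ((-((k + 2 + j : ℕ) : ℝ) • coeff hV (k + 1) j v w - coeff hV (k + 1) (j + 1) v w : BC) y)
        w := fun k j w hw y => by
    refine ((hasDerivAt_coeffFun hV k j v (h0 w hw) y).ofReal_comp).congr_deriv ?_
    simp [coeff_apply]
  obtain ⟨C1, h1⟩ := exists_norm_coeff_le hV (k + 2) j (v := fun _ : Unit => v)
    (fun _ => le_rfl) hc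
  obtain ⟨C2, h2⟩ := exists_norm_coeff_le hV (k + 2) (j + 1) (v := fun _ : Unit => v)
    (fun _ => le_rfl) hc
  obtain ⟨C3, h3⟩ := exists_norm_coeff_le hV (k + 2) (j + 2) (v := fun _ : Unit => v)
    (fun _ => le_rfl) hc
  refine hasDerivAt_boundedContinuousFunction (isOpen_lt_abs (|ω| / 2))
    (f₁ := fun w => -((k + 2 + j : ℕ) : ℝ) • coeff hV (k + 1) j v w -
      coeff hV (k + 1) (j + 1) v w)
    (f₂ := fun w => -((k + 2 + j : ℕ) : ℝ) •
        (-((k + 1 + 2 + j : ℕ) : ℝ) • coeff hV (k + 2) j v w - coeff hV (k + 2) (j + 1) v w) -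
      (-((k + 1 + 2 + (j + 1) : ℕ) : ℝ) • coeff hV (k + 2) (j + 1) v w -
        coeff hV (k + 2) (j + 2) v w))
    (C := (k + 2 + j : ℕ) * ((k + 1 + 2 + j : ℕ) * C1 + C2) +
      ((k + 1 + 2 + (j + 1) : ℕ) * C2 + C3))
    (key k j) (fun w hw y => ?_) (fun w hw => ?_) (show |ω| / 2 < |ω| by linarith)
  · exact ((key (k + 1) j w hw y).const_smul (-((k + 2 + j : ℕ) : ℝ))).sub
      (key (k + 1) (j + 1) w hw y)
  · have n1 := h1 () w hw
    have n2 := h2 () w hw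
    have n3 := h3 () w hw
    have hs : ∀ (m : ℕ) (f : BC), ‖-(m : ℝ) • f‖ = m * ‖f‖ := fun m f => by
      rw [norm_smul, norm_neg, Real.norm_natCast]
    refine (norm_sub_le _ _).trans (add_le_add ?_ ((norm_sub_le _ _).trans (add_le_add ?_ n3)))
    · rw [hs]
      refine mul_le_mul_of_nonneg_left ((norm_sub_le _ _).trans (add_le_add ?_ n2))
        (Nat.cast_nonneg _)
      rw [hs]
      exact mul_le_mul_of_nonneg_left n1 (Nat.cast_nonneg _)
    · rw [hs]
      exact mul_le_mul_of_nonneg_left n2 (Nat.cast_nonneg _)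

theorem bddDeriv_coeff (hV : IsSymbol V) (n k j : ℕ) {ι : Type*} {v : ι → ℝ} {B : ℝ}
    (hv : ∀ i, |v i| ≤ B) {c : ℝ} (hc : 0 < c) :
    BddDeriv {ω : ℝ | c < |ω|} n fun i ω => coeff hV k j (v i) ω := by
  induction n generalizing k j with
  | zero => exact exists_norm_coeff_le hV k j hv hc
  | succ n ih =>
    exact ⟨exists_norm_coeff_le hV k j hv hc, _,
      fun i ω hω => hasDerivAt_coeff hV k j (v i) (abs_pos.1 (hc.trans hω)),
      ((ih (k + 1) j).clm (-((k + 2 + j : ℕ) : ℝ) • ContinuousLinearMap.id ℝ BC)).sub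
        (ih (k + 1) (j + 1))⟩

end Symbol

/-! ### Jost solutions of a general potential -/

section Jost

variable {V : ℝ → ℝ}

/-- The iteration scheme of the Jost equation with boundary conditions at `+∞`, for an arbitrary
potential. -/
noncomputable def jostIter (V : ℝ → ℝ) (ω : ℂ) : ℕ → ℝ → ℂ
  | 0, u => Complex.exp (-(Complex.I * ω * u))
  | k + 1, u => -∫ v in Set.Ioi u,
      1 / ω * Complex.sin (ω * (u - v)) * (V v : ℂ) * jostIter V ω k v

/-- The sum of the iteration scheme `jostIter`. -/
noncomputable def jost (V : ℝ → ℝ) (ω : ℂ) (u : ℝ) : ℂ := ∑' k, jostIter V ω k u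

theorem norm_exp_neg_I_mul (a b : ℝ) : ‖Complex.exp (-(Complex.I * a * b))‖ = 1 := by
  have : -(Complex.I * a * b) = ((-(a * b) : ℝ) : ℂ) * Complex.I := by push_cast; ring
  rw [this, Complex.norm_exp_ofReal_mul_I]

/-- The plane wave `exp (-iσx)`, as a bounded continuous function. -/
noncomputable def wave (σ : ℝ) : BC :=
  BoundedContinuousFunction.ofNormedAddCommGroup
    (fun x : ℝ => Complex.exp (-(Complex.I * σ * x))) (by fun_prop) 1
    fun x => (norm_exp_neg_I_mul σ x).le

theorem wave_apply (σ x : ℝ) : wave σ x = Complex.exp (-(Complex.I * σ * x)) := rfl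

theorem inv_mul_sin_eq_abs (ω t : ℝ) : ω⁻¹ * Real.sin (ω * t) = |ω|⁻¹ * Real.sin (|ω| * t) := by
  rcases abs_choice ω with h | h <;> rw [h]
  rw [inv_neg, neg_mul ω, Real.sin_neg, neg_mul_neg]

theorem jost_kernel_eq (ω u w : ℝ) :
    -(1 / (ω : ℂ) * Complex.sin (ω * (u - w))) =
      ((|ω|⁻¹ * Real.sin (|ω| * (w - u)) : ℝ) : ℂ) := by
  rw [← inv_mul_sin_eq_abs]
  push_cast
  rw [← neg_sub (w : ℂ) u, mul_neg, Complex.sin_neg]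
  ring

/-- In the coordinate `y = |ω| (w - v)`, the integral operator of the Jost equation becomes
`volterraOp`. -/
theorem jost_integral_rescale (hV : IsSymbol V) {ω : ℝ} (hω : ω ≠ 0) (v : ℝ) {h : ℝ → ℂ}
    {f : BC} {a : ℂ} (hf : ∀ y, h (v + y / |ω|) = a * f y) {u x : ℝ} (hu : u = v + x / |ω|) :
    -∫ w in Set.Ioi u, 1 / (ω : ℂ) * Complex.sin (ω * (u - w)) * (V w : ℂ) * h w =
      a * volterraOp (coeff hV 0 0 v ω) f x := by
  have ha : 0 < |ω| := abs_pos.2 hω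
  let g : ℝ → ℂ := fun w =>
    ((|ω|⁻¹ * Real.sin (max (|ω| * (w - u)) 0) : ℝ) : ℂ) * (V w : ℂ) * h w
  have h1 : -∫ w in Set.Ioi u, 1 / (ω : ℂ) * Complex.sin (ω * (u - w)) * (V w : ℂ) * h w =
      ∫ w, g w := by
    rw [← integral_neg, ← setIntegral_eq_integral_of_forall_compl_eq_zero (s := Set.Ioi u) (f := g)]
    · refine setIntegral_congr_fun measurableSet_Ioi fun w hw => ?_
      have hpos : 0 ≤ |ω| * (w - u) := mul_nonneg ha.le (sub_nonneg.2 (le_of_lt hw))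
      simp only [g]
      rw [max_eq_left hpos, ← jost_kernel_eq]
      ring
    · intro w hw
      have hneg : |ω| * (w - u) ≤ 0 :=
        mul_nonpos_of_nonneg_of_nonpos ha.le (sub_nonpos.2 (not_lt.1 hw))
      simp [g, max_eq_right hneg]
  have h2 : ∫ w, g w = |ω|⁻¹ • ∫ y, g (v + y / |ω|) := by
    rw [Measure.integral_comp_div (fun z => g (v + z)), abs_abs, smul_smul,
      inv_mul_cancel₀ ha.ne', one_smul, integral_add_left_eq_self]
  rw [h1, h2, volterraOp_apply, ← integral_const_mul, ← integral_smul]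
  refine integral_congr_ae (Eventually.of_forall fun y => ?_)
  have e1 : |ω| * (v + y / |ω| - u) = y - x := by
    rw [hu]
    field_simp
    ring
  have e2 : ω⁻¹ ^ 2 = |ω|⁻¹ * |ω|⁻¹ := by rw [← mul_inv, abs_mul_abs_self, inv_pow, sq]
  have e3 : (1 + y ^ 2)⁻¹ * (1 + y ^ 2) = 1 := inv_mul_cancel₀ (by positivity)
  simp only [g, coeff_apply, hf, e1, volterraKernel, coeffFun, pow_zero, one_mul, zero_add,
    iteratedDeriv_zero, Complex.real_smul, e2]
  have e4 : (((1 + y ^ 2)⁻¹ : ℝ) : ℂ) * ((1 + y ^ 2 : ℝ) : ℂ) = 1 := by exact_mod_cast e3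
  simp only [Complex.ofReal_mul]
  linear_combination (-(a * f y * Real.sin (max (y - x) 0) * V (v + y / |ω|) *
    ((|ω|⁻¹ : ℝ) : ℂ) * ((|ω|⁻¹ : ℝ) : ℂ))) * e4

/-- The iteration scheme is the Neumann series of the rescaled equation, term by term. -/
theorem jostIter_eq (hV : IsSymbol V) {ω : ℝ} (hω : ω ≠ 0) (v : ℝ) (k : ℕ) (x : ℝ) :
    jostIter V ω k (v + x / |ω|) = Complex.exp (-(Complex.I * ω * v)) *
      (volterraOp (coeff hV 0 0 v ω) ^ k) (wave (ω / |ω|)) x := by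
  induction k generalizing x with
  | zero =>
    rw [pow_zero, one_apply_eq_self, wave_apply, ← Complex.exp_add, jostIter]
    push_cast
    congr 1
    ring
  | succ k ih =>
    rw [pow_succ', mul_apply_eq_comp, jostIter]
    exact jost_integral_rescale hV hω v ih rfl

/-- The Jost solution of the rescaled equation on the half-line from `v`, in the coordinate
`y = |ω| (x - v)`, up to the factor `exp (-iωv)`. -/
noncomputable def rescaledJost (hV : IsSymbol V) (v ω : ℝ) : BC :=
  resolvent (coeff hV 0 0 v ω) (wave (ω / |ω|))

theorem hasSum_jostIter (hV : IsSymbol V) {ω : ℝ} (hω : ω ≠ 0) (v x : ℝ) :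
    HasSum (fun k => jostIter V ω k (v + x / |ω|))
      (Complex.exp (-(Complex.I * ω * v)) * rescaledJost hV v ω x) := by
  simp only [jostIter_eq hV hω]
  exact (hasSum_resolvent_apply _ _ x).mul_left _

theorem jost_eq_rescaled (hV : IsSymbol V) {ω : ℝ} (hω : ω ≠ 0) (v x : ℝ) :
    jost V ω (v + x / |ω|) = Complex.exp (-(Complex.I * ω * v)) * rescaledJost hV v ω x :=
  (hasSum_jostIter hV hω v x).tsum_eq

theorem jost_eq (hV : IsSymbol V) {ω : ℝ} (hω : ω ≠ 0) (v : ℝ) :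
    jost V ω v = Complex.exp (-(Complex.I * ω * v)) * rescaledJost hV v ω 0 := by
  simpa using jost_eq_rescaled hV hω v 0

theorem jost_eq_rescaled_zero (hV : IsSymbol V) {ω : ℝ} (hω : ω ≠ 0) (u : ℝ) :
    jost V ω u = rescaledJost hV 0 ω (|ω| * u) := by
  have := jost_eq_rescaled hV hω 0 (|ω| * u)
  rwa [zero_add, mul_div_cancel_left₀ _ (abs_ne_zero.2 hω), Complex.ofReal_zero, mul_zero,
    neg_zero, Complex.exp_zero, one_mul] at this

theorem jost_integral_eq (hV : IsSymbol V) {ω : ℝ} (hω : ω ≠ 0) (u : ℝ) :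
    jost V ω u = Complex.exp (-(Complex.I * ω * u)) -
      ∫ w in Set.Ioi u, 1 / (ω : ℂ) * Complex.sin (ω * (u - w)) * (V w : ℂ) * jost V ω w := by
  rw [sub_eq_add_neg, jost_integral_rescale hV hω u (jost_eq_rescaled hV hω u) (x := 0) (by simp),
    jost_eq hV hω]
  have h : rescaledJost hV u ω =
      wave (ω / |ω|) + volterraOp (coeff hV 0 0 u ω) (rescaledJost hV u ω) :=
    resolvent_apply_eq _ _
  conv_lhs => rw [h, BoundedContinuousFunction.add_apply, wave_apply]
  simp [mul_add]

theorem continuous_jost (hV : IsSymbol V) {ω : ℝ} (hω : ω ≠ 0) : Continuous (jost V ω) := by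
  have : jost V ω = fun u => rescaledJost hV 0 ω (|ω| * u) :=
    funext fun u => jost_eq_rescaled_zero hV hω u
  rw [this]
  exact (rescaledJost hV 0 ω).continuous.comp (by fun_prop)

theorem norm_jost_le (hV : IsSymbol V) {ω : ℝ} (hω : ω ≠ 0) (u : ℝ) :
    ‖jost V ω u‖ ≤ ‖rescaledJost hV 0 ω‖ := by
  rw [jost_eq_rescaled_zero hV hω]
  exact BoundedContinuousFunction.norm_coe_le_norm _ _

/-- The source term `V φ` of the Schrödinger equation. -/
noncomputable def source (V : ℝ → ℝ) (ω : ℝ) (w : ℝ) : ℂ := V w * jost V ω w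

theorem continuous_source (hV : IsSymbol V) {ω : ℝ} (hω : ω ≠ 0) :
    Continuous (source V ω) :=
  (Complex.continuous_ofReal.comp hV.contDiff.continuous).mul (continuous_jost hV hω)

theorem integrable_source (hV : IsSymbol V) {ω : ℝ} (hω : ω ≠ 0) : Integrable (source V ω) := by
  refine (hV.integrable.norm.mul_const ‖rescaledJost hV 0 ω‖).mono'
    (continuous_source hV hω).aestronglyMeasurable (Eventually.of_forall fun w => ?_)
  rw [source, norm_mul, Complex.norm_real]
  exact mul_le_mul_of_nonneg_left (norm_jost_le hV hω w) (norm_nonneg _)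

theorem norm_cos_ofReal_le (t : ℝ) : ‖Complex.cos t‖ ≤ 1 := by
  rw [← Complex.ofReal_cos, Complex.norm_real]
  exact Real.abs_cos_le_one t

theorem norm_sin_ofReal_le (t : ℝ) : ‖Complex.sin t‖ ≤ 1 := by
  rw [← Complex.ofReal_sin, Complex.norm_real]
  exact Real.abs_sin_le_one t

theorem integrable_cos_mul {h : ℝ → ℂ} (hi : Integrable h) (hc : Continuous h) (ω : ℝ) :
    Integrable fun w : ℝ => Complex.cos (ω * w) * h w := by
  refine hi.norm.mono' (by fun_prop) (Eventually.of_forall fun w => ?_)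
  rw [norm_mul]
  refine mul_le_of_le_one_left (norm_nonneg _) ?_
  exact_mod_cast norm_cos_ofReal_le (ω * w)

theorem integrable_sin_mul {h : ℝ → ℂ} (hi : Integrable h) (hc : Continuous h) (ω : ℝ) :
    Integrable fun w : ℝ => Complex.sin (ω * w) * h w := by
  refine hi.norm.mono' (by fun_prop) (Eventually.of_forall fun w => ?_)
  rw [norm_mul]
  refine mul_le_of_le_one_left (norm_nonneg _) ?_
  exact_mod_cast norm_sin_ofReal_le (ω * w)

theorem integral_Ioi_eq_sub {g : ℝ → ℂ} (hi : Integrable g) (x : ℝ) :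
    ∫ w in Set.Ioi x, g w = (∫ w in Set.Ioi 0, g w) - ∫ w in (0 : ℝ)..x, g w := by
  rw [← intervalIntegral.integral_interval_add_Ioi hi.integrableOn hi.integrableOn (a := 0) (b := x)]
  ring

theorem hasDerivAt_integral_Ioi {g : ℝ → ℂ} (hi : Integrable g) (hc : Continuous g) (x : ℝ) :
    HasDerivAt (fun x => ∫ w in Set.Ioi x, g w) (-g x) x := by
  rw [funext (integral_Ioi_eq_sub hi)]
  exact (intervalIntegral.integral_hasDerivAt_right hi.intervalIntegrable
    (hc.stronglyMeasurableAtFilter _ _) hc.continuousAt).const_sub _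

theorem tendsto_integral_Ioi {g : ℝ → ℂ} (hi : Integrable g) :
    Tendsto (fun x => ∫ w in Set.Ioi x, g w) atTop (𝓝 0) := by
  rw [funext (integral_Ioi_eq_sub hi)]
  have := (intervalIntegral_tendsto_integral_Ioi 0 hi.integrableOn tendsto_id).const_sub
    (∫ w in Set.Ioi 0, g w)
  simpa using this

/-- `∫_u^∞ cos (ωw) V φ dw` -/
noncomputable def cosTail (V : ℝ → ℝ) (ω u : ℝ) : ℂ :=
  ∫ w in Set.Ioi u, Complex.cos (ω * w) * source V ω w

/-- `∫_u^∞ sin (ωw) V φ dw` -/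
noncomputable def sinTail (V : ℝ → ℝ) (ω u : ℝ) : ℂ :=
  ∫ w in Set.Ioi u, Complex.sin (ω * w) * source V ω w

theorem hasDerivAt_cosTail (hV : IsSymbol V) {ω : ℝ} (hω : ω ≠ 0) (u : ℝ) :
    HasDerivAt (cosTail V ω) (-(Complex.cos (ω * u) * source V ω u)) u :=
  hasDerivAt_integral_Ioi
    (integrable_cos_mul (integrable_source hV hω) (continuous_source hV hω) ω)
    ((by fun_prop : Continuous fun w : ℝ => Complex.cos (ω * w)).mul (continuous_source hV hω)) u

theorem hasDerivAt_sinTail (hV : IsSymbol V) {ω : ℝ} (hω : ω ≠ 0) (u : ℝ) :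
    HasDerivAt (sinTail V ω) (-(Complex.sin (ω * u) * source V ω u)) u :=
  hasDerivAt_integral_Ioi
    (integrable_sin_mul (integrable_source hV hω) (continuous_source hV hω) ω)
    ((by fun_prop : Continuous fun w : ℝ => Complex.sin (ω * w)).mul (continuous_source hV hω)) u

theorem jost_eq_tails (hV : IsSymbol V) {ω : ℝ} (hω : ω ≠ 0) (u : ℝ) :
    jost V ω u = Complex.exp (-(Complex.I * ω * u)) -
      1 / ω * (Complex.sin (ω * u) * cosTail V ω u - Complex.cos (ω * u) * sinTail V ω u) := by
  rw [jost_integral_eq hV hω, cosTail, sinTail]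
  congr 1
  have h1 := integrable_cos_mul (integrable_source hV hω) (continuous_source hV hω) ω
  have h2 := integrable_sin_mul (integrable_source hV hω) (continuous_source hV hω) ω
  rw [← integral_const_mul, ← integral_const_mul, ← integral_sub
    (h1.integrableOn.const_mul _) (h2.integrableOn.const_mul _), ← integral_const_mul]
  refine integral_congr_ae (Eventually.of_forall fun w => ?_)
  simp only [source]
  rw [mul_sub, Complex.sin_sub]
  ring

/-- The derivative of the Jost solution. -/
noncomputable def jostDeriv (V : ℝ → ℝ) (ω u : ℝ) : ℂ :=
  -(Complex.I * ω) * Complex.exp (-(Complex.I * ω * u)) -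
    (Complex.cos (ω * u) * cosTail V ω u + Complex.sin (ω * u) * sinTail V ω u)

theorem hasDerivAt_exp_neg_I_mul (ω u : ℝ) :
    HasDerivAt (fun u : ℝ => Complex.exp (-(Complex.I * ω * u)))
      (-(Complex.I * ω) * Complex.exp (-(Complex.I * ω * u))) u := by
  have h := ((hasDerivAt_id (u : ℂ)).const_mul (-(Complex.I * (ω : ℂ)))).cexp.comp_ofReal
  simp only [id, neg_mul] at h
  exact h.congr_deriv (by ring)

theorem hasDerivAt_sin_mul (ω u : ℝ) :
    HasDerivAt (fun u : ℝ => Complex.sin (ω * u)) (ω * Complex.cos (ω * u)) u := by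
  have h := ((hasDerivAt_id (u : ℂ)).const_mul (ω : ℂ)).csin.comp_ofReal
  simp only [id] at h
  exact h.congr_deriv (by ring)

theorem hasDerivAt_cos_mul (ω u : ℝ) :
    HasDerivAt (fun u : ℝ => Complex.cos (ω * u)) (-(ω * Complex.sin (ω * u))) u := by
  have h := ((hasDerivAt_id (u : ℂ)).const_mul (ω : ℂ)).ccos.comp_ofReal
  simp only [id] at h
  exact h.congr_deriv (by ring)

theorem hasDerivAt_jost (hV : IsSymbol V) {ω : ℝ} (hω : ω ≠ 0) (u : ℝ) :
    HasDerivAt (jost V ω) (jostDeriv V ω u) u := by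
  rw [funext (jost_eq_tails hV hω)]
  refine ((hasDerivAt_exp_neg_I_mul ω u).sub
    ((((hasDerivAt_sin_mul ω u).mul (hasDerivAt_cosTail hV hω u)).sub
      ((hasDerivAt_cos_mul ω u).mul (hasDerivAt_sinTail hV hω u))).const_mul
        (1 / (ω : ℂ)))).congr_deriv ?_
  have : (ω : ℂ) ≠ 0 := by exact_mod_cast hω
  rw [jostDeriv]
  field_simp
  ring

theorem hasDerivAt_jostDeriv (hV : IsSymbol V) {ω : ℝ} (hω : ω ≠ 0) (u : ℝ) :
    HasDerivAt (jostDeriv V ω) ((-(ω : ℂ) ^ 2 + V u) * jost V ω u) u := by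
  refine (((hasDerivAt_exp_neg_I_mul ω u).const_mul (-(Complex.I * ω))).sub
    (((hasDerivAt_cos_mul ω u).mul (hasDerivAt_cosTail hV hω u)).add
      ((hasDerivAt_sin_mul ω u).mul (hasDerivAt_sinTail hV hω u)))).congr_deriv ?_
  have h0 : (ω : ℂ) ≠ 0 := by exact_mod_cast hω
  have e1 : (V u : ℂ) * jost V ω u = source V ω u := rfl
  rw [add_mul, e1, jost_eq_tails hV hω]
  have e2 := Complex.sin_sq_add_cos_sq (ω * u)
  field_simp
  linear_combination (source V ω u) * e2 +
    (ω : ℂ) ^ 2 * Complex.exp (-(Complex.I * ω * u)) * Complex.I_sq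

theorem tendsto_cosTail (hV : IsSymbol V) {ω : ℝ} (hω : ω ≠ 0) :
    Tendsto (cosTail V ω) atTop (𝓝 0) :=
  tendsto_integral_Ioi (integrable_cos_mul (integrable_source hV hω) (continuous_source hV hω) ω)

theorem tendsto_sinTail (hV : IsSymbol V) {ω : ℝ} (hω : ω ≠ 0) :
    Tendsto (sinTail V ω) atTop (𝓝 0) :=
  tendsto_integral_Ioi (integrable_sin_mul (integrable_source hV hω) (continuous_source hV hω) ω)

theorem tendsto_cos_mul {f : ℝ → ℂ} (hf : Tendsto f atTop (𝓝 0)) (ω : ℝ) :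
    Tendsto (fun u : ℝ => Complex.cos (ω * u) * f u) atTop (𝓝 0) :=
  squeeze_zero_norm (fun u => by
    rw [norm_mul]
    refine mul_le_of_le_one_left (norm_nonneg _) ?_
    exact_mod_cast norm_cos_ofReal_le (ω * u)) (tendsto_norm_zero.comp hf)

theorem tendsto_sin_mul {f : ℝ → ℂ} (hf : Tendsto f atTop (𝓝 0)) (ω : ℝ) :
    Tendsto (fun u : ℝ => Complex.sin (ω * u) * f u) atTop (𝓝 0) :=
  squeeze_zero_norm (fun u => by
    rw [norm_mul]
    refine mul_le_of_le_one_left (norm_nonneg _) ?_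
    exact_mod_cast norm_sin_ofReal_le (ω * u)) (tendsto_norm_zero.comp hf)

theorem tendsto_jost_sub (hV : IsSymbol V) {ω : ℝ} (hω : ω ≠ 0) :
    Tendsto (fun u : ℝ => jost V ω u - Complex.exp (-(Complex.I * ω * u))) atTop (𝓝 0) := by
  have h := ((tendsto_sin_mul (tendsto_cosTail hV hω) ω).sub
    (tendsto_cos_mul (tendsto_sinTail hV hω) ω)).const_mul (-(1 / (ω : ℂ)))
  rw [sub_zero, mul_zero] at h
  refine h.congr fun u => ?_
  rw [jost_eq_tails hV hω]
  ring

theorem tendsto_jostDeriv_add (hV : IsSymbol V) {ω : ℝ} (hω : ω ≠ 0) :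
    Tendsto (fun u : ℝ => jostDeriv V ω u + Complex.I * ω * Complex.exp (-(Complex.I * ω * u)))
      atTop (𝓝 0) := by
  have h := ((tendsto_cos_mul (tendsto_cosTail hV hω) ω).add
    (tendsto_sin_mul (tendsto_sinTail hV hω) ω)).neg
  rw [add_zero, neg_zero] at h
  refine h.congr fun u => ?_
  rw [jostDeriv]
  ring

end Jost

/-! ### Dependence of the Jost solutions on the frequency -/

section JostParameter

variable {V : ℝ → ℝ} {ι : Type*} {S : Set ℝ} {n : ℕ}

theorem bddDeriv_exp {v : ι → ℝ} {B : ℝ} (hv : ∀ i, |v i| ≤ B) :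
    BddDeriv S n fun i ω => Complex.exp (-(Complex.I * ω * v i)) := by
  have hb : ∀ i, ∀ ω ∈ S, ‖Complex.exp (-(Complex.I * (ω : ℝ) * v i))‖ ≤ 1 :=
    fun i ω _ => (norm_exp_neg_I_mul ω (v i)).le
  induction n with
  | zero => exact ⟨1, hb⟩
  | succ n ih =>
    refine ⟨⟨1, hb⟩, fun i ω => -(Complex.I * v i) * Complex.exp (-(Complex.I * ω * v i)),
      fun i ω _ => ?_, (BddDeriv.const (C := B) fun i => ?_).mul ih⟩
    · have h := hasDerivAt_exp_neg_I_mul (v i) ω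
      simp only [mul_right_comm Complex.I ((v i : ℝ) : ℂ)] at h
      exact h
    · simpa using hv i

/-- A function of the sign `ω / |ω|` is locally constant away from `0`. -/
theorem bddDeriv_comp_sign {E : Type*} [NormedAddCommGroup E] [NormedSpace ℝ E] (F : ℝ → E)
    {c : ℝ} (hc : 0 < c) :
    BddDeriv {ω : ℝ | c < |ω|} n fun (_ : ι) ω => F (ω / |ω|) := by
  have hval : ∀ ω : ℝ, ω ≠ 0 → ‖F (ω / |ω|)‖ ≤ ‖F 1‖ + ‖F (-1)‖ := by
    intro ω hω
    rcases lt_or_gt_of_ne hω with h | h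
    · rw [abs_of_neg h, div_neg, div_self hω]
      linarith [norm_nonneg (F 1)]
    · rw [abs_of_pos h, div_self hω]
      linarith [norm_nonneg (F (-1))]
  have h0 : ∀ ω ∈ {ω : ℝ | c < |ω|}, ω ≠ 0 := fun ω hω => abs_pos.1 (hc.trans hω)
  cases n with
  | zero => exact ⟨_, fun _ ω hω => hval ω (h0 ω hω)⟩
  | succ n =>
    refine ⟨⟨_, fun _ ω hω => hval ω (h0 ω hω)⟩, fun _ _ => 0, fun _ ω hω => ?_, BddDeriv.zero⟩
    refine (hasDerivAt_const ω (F (ω / |ω|))).congr_of_eventuallyEq ?_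
    rcases lt_or_gt_of_ne (h0 ω hω) with h | h
    · filter_upwards [gt_mem_nhds h] with w hw
      rw [abs_of_neg h, abs_of_neg hw, div_neg, div_neg, div_self h.ne, div_self hw.ne]
    · filter_upwards [lt_mem_nhds h] with w hw
      rw [abs_of_pos h, abs_of_pos hw, div_self h.ne', div_self hw.ne']

theorem bddDeriv_inv {c : ℝ} (hc : 0 < c) :
    BddDeriv {ω : ℝ | c < |ω|} n fun (_ : ι) ω => (ω : ℂ)⁻¹ := by
  have hb : ∀ _ : ι, ∀ ω ∈ {ω : ℝ | c < |ω|}, ‖(ω : ℂ)⁻¹‖ ≤ c⁻¹ := fun _ ω hω => by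
    rw [norm_inv, Complex.norm_real]
    exact inv_anti₀ hc (le_of_lt hω)
  induction n with
  | zero => exact ⟨_, hb⟩
  | succ n ih =>
    refine ⟨⟨_, hb⟩, fun _ ω => -((ω : ℂ)⁻¹ * (ω : ℂ)⁻¹), fun _ ω hω => ?_, (ih.mul ih).neg⟩
    have h0 : (ω : ℂ) ≠ 0 := by exact_mod_cast abs_pos.1 (hc.trans hω)
    refine (hasDerivAt_inv h0).comp_ofReal.congr_deriv ?_
    rw [sq, mul_inv]

theorem bddDeriv_rescaledJost (hV : IsSymbol V) {v : ι → ℝ} {B : ℝ} (hv : ∀ i, |v i| ≤ B)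
    {c : ℝ} (hc : 0 < c) :
    BddDeriv {ω : ℝ | c < |ω|} n fun i ω => rescaledJost hV (v i) ω :=
  (BddDeriv.resolvent (isOpen_lt_abs c) (bddDeriv_coeff hV n 0 0 hv hc)).bilin
    (ContinuousLinearMap.id ℝ (BC →L[ℝ] BC)) (bddDeriv_comp_sign wave hc)

/-- The Jost solutions at points of a bounded set are smooth in `ω ≠ 0`, with derivatives which are
bounded away from `ω = 0`. -/
theorem bddDeriv_jost (hV : IsSymbol V) {v : ι → ℝ} {B : ℝ} (hv : ∀ i, |v i| ≤ B)
    {c : ℝ} (hc : 0 < c) : BddDeriv {ω : ℝ | c < |ω|} n fun i ω => jost V ω (v i) :=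
  ((bddDeriv_exp hv).mul ((bddDeriv_rescaledJost hV hv hc).clm
    (BoundedContinuousFunction.evalCLM ℝ 0))).congr (isOpen_lt_abs c) fun i _ hω =>
      jost_eq hV (abs_pos.1 (hc.trans hω)) (v i)

theorem continuous_cos_weight_mul (g : BC) :
    Continuous fun y : ℝ => ((Real.cos y * (1 + y ^ 2)⁻¹ : ℝ) : ℂ) * g y :=
  (Complex.continuous_ofReal.comp (Real.continuous_cos.mul continuous_weight)).mul g.continuous

theorem norm_cos_weight_mul_le (g : BC) (y : ℝ) :
    ‖((Real.cos y * (1 + y ^ 2)⁻¹ : ℝ) : ℂ) * g y‖ ≤ (1 + y ^ 2)⁻¹ * ‖g‖ := by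
  rw [norm_mul, Complex.norm_real, norm_mul, Real.norm_of_nonneg (r := (1 + y ^ 2)⁻¹)
    (by positivity)]
  exact mul_le_mul (mul_le_of_le_one_left (by positivity) (Real.abs_cos_le_one y))
    (g.norm_coe_le_norm y) (norm_nonneg _) (by positivity)

theorem integrable_cos_weight_mul (g : BC) :
    Integrable fun y : ℝ => ((Real.cos y * (1 + y ^ 2)⁻¹ : ℝ) : ℂ) * g y :=
  (integrable_inv_one_add_sq.mul_const ‖g‖).mono' (continuous_cos_weight_mul g).aestronglyMeasurable
    (Eventually.of_forall fun y => norm_cos_weight_mul_le g y)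

/-- The functional `g ↦ ∫_0^∞ cos y (1 + y²)⁻¹ g y dy`. -/
noncomputable def cosFunctional : BC →L[ℝ] ℂ :=
  LinearMap.mkContinuous
    { toFun := fun g => ∫ y in Set.Ioi (0 : ℝ), ((Real.cos y * (1 + y ^ 2)⁻¹ : ℝ) : ℂ) * g y
      map_add' := fun f g => by
        simp only [BoundedContinuousFunction.coe_add, Pi.add_apply, mul_add]
        exact integral_add (integrable_cos_weight_mul f).integrableOn
          (integrable_cos_weight_mul g).integrableOn
      map_smul' := fun c g => by
        simp only [BoundedContinuousFunction.coe_smul, mul_smul_comm, RingHom.id_apply]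
        exact integral_smul c _ }
    Real.pi fun g => by
      refine (norm_integral_le_of_norm_le (integrable_inv_one_add_sq.mul_const ‖g‖).integrableOn
        (Eventually.of_forall fun y => norm_cos_weight_mul_le g y)).trans ?_
      rw [← integral_univ_inv_one_add_sq, ← integral_mul_const]
      exact setIntegral_le_integral (integrable_inv_one_add_sq.mul_const ‖g‖)
        (Eventually.of_forall fun y => by positivity)

theorem cosFunctional_apply (g : BC) :
    cosFunctional g = ∫ y in Set.Ioi (0 : ℝ), ((Real.cos y * (1 + y ^ 2)⁻¹ : ℝ) : ℂ) * g y := rfl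

/-- The derivative of the Jost solution at `v`, in terms of the rescaled solution. Division by `ω`
makes it bounded for large `ω`. -/
theorem inv_mul_jostDeriv_eq (hV : IsSymbol V) {ω : ℝ} (hω : ω ≠ 0) (v : ℝ) :
    (ω : ℂ)⁻¹ * jostDeriv V ω v = Complex.exp (-(Complex.I * ω * v)) * (-Complex.I -
      ((ω / |ω| : ℝ) : ℂ) * cosFunctional (coeff hV 0 0 v ω * rescaledJost hV v ω)) := by
  have ha : 0 < |ω| := abs_pos.2 hω
  have h0 : (ω : ℂ) ≠ 0 := by exact_mod_cast hω
  let g : ℝ → ℂ := fun w => ((Real.cos (ω * (w - v)) : ℝ) : ℂ) * source V ω w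
  have h1 : Complex.cos (ω * v) * cosTail V ω v + Complex.sin (ω * v) * sinTail V ω v =
      ∫ w in Set.Ioi v, g w := by
    have i1 := integrable_cos_mul (integrable_source hV hω) (continuous_source hV hω) ω
    have i2 := integrable_sin_mul (integrable_source hV hω) (continuous_source hV hω) ω
    rw [cosTail, sinTail, ← integral_const_mul, ← integral_const_mul,
      ← integral_add (i1.integrableOn.const_mul _) (i2.integrableOn.const_mul _)]
    refine integral_congr_ae (Eventually.of_forall fun w => ?_)
    simp only [g]
    push_cast
    rw [mul_sub, Complex.cos_sub]
    ring
  have h2 : ∫ w in Set.Ioi v, g w = |ω|⁻¹ • ∫ y in Set.Ioi (0 : ℝ), g (v + y / |ω|) := by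
    have e1 : ∀ y, v + y / |ω| = v + |ω|⁻¹ * y := fun y => by rw [div_eq_inv_mul]
    simp only [e1]
    rw [integral_comp_mul_left_Ioi (fun z => g (v + z)) 0 (inv_pos.2 ha), mul_zero, inv_inv,
      smul_smul, inv_mul_cancel₀ ha.ne', one_smul]
    have h := (measurePreserving_add_left volume v).setIntegral_preimage_emb
      (measurableEmbedding_addLeft v) g (Set.Ioi v)
    rw [Set.preimage_const_add_Ioi, sub_self] at h
    exact h.symm
  have h3 : ∀ y, g (v + y / |ω|) = (Complex.exp (-(Complex.I * ω * v)) * ((|ω| : ℝ) : ℂ) ^ 2) *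
      (((Real.cos y * (1 + y ^ 2)⁻¹ : ℝ) : ℂ) *
        (coeff hV 0 0 v ω * rescaledJost hV v ω : BC) y) := by
    intro y
    have e1 : Real.cos (ω * (v + y / |ω| - v)) = Real.cos y := by
      rw [add_sub_cancel_left]
      rcases abs_choice ω with h | h <;> rw [h]
      · rw [mul_div_cancel₀ _ hω]
      · rw [div_neg, mul_neg, mul_div_cancel₀ _ hω, Real.cos_neg]
    have e4 : (((1 + y ^ 2)⁻¹ : ℝ) : ℂ) * ((1 + y ^ 2 : ℝ) : ℂ) = 1 := by
      exact_mod_cast inv_mul_cancel₀ (by positivity : (1 + y ^ 2 : ℝ) ≠ 0)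
    have e5 : ((|ω| : ℝ) : ℂ) ^ 2 * ((ω⁻¹ ^ 2 : ℝ) : ℂ) = 1 := by
      have : |ω| ^ 2 * ω⁻¹ ^ 2 = 1 := by
        rw [sq_abs, ← mul_pow, mul_inv_cancel₀ hω, one_pow]
      exact_mod_cast this
    simp only [g, e1, source, jost_eq_rescaled hV hω, BoundedContinuousFunction.mul_apply,
      coeff_apply, coeffFun, pow_zero, one_mul, zero_add, iteratedDeriv_zero]
    rw [Complex.ofReal_mul (Real.cos y), Complex.ofReal_mul (1 + y ^ 2),
      Complex.ofReal_mul (ω⁻¹ ^ 2)]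
    generalize (((1 + y ^ 2)⁻¹ : ℝ) : ℂ) = A at *
    generalize ((1 + y ^ 2 : ℝ) : ℂ) = A' at *
    generalize ((ω⁻¹ ^ 2 : ℝ) : ℂ) = D at *
    linear_combination (-(Real.cos y : ℂ) * V (v + y / |ω|) *
      (Complex.exp (-(Complex.I * ω * v)) * rescaledJost hV v ω y)) * (e4 + A * A' * e5)
  have e6 : (ω : ℂ)⁻¹ * ((|ω| : ℝ) : ℂ) = ((ω / |ω| : ℝ) : ℂ) := by
    have : ω⁻¹ * |ω| = ω / |ω| := by
      field_simp
      rw [sq_abs]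
    exact_mod_cast this
  have e7 : ((|ω|⁻¹ : ℝ) : ℂ) * ((|ω| : ℝ) : ℂ) = 1 := by
    exact_mod_cast inv_mul_cancel₀ ha.ne'
  rw [jostDeriv, h1, h2]
  simp only [h3]
  rw [integral_const_mul, ← cosFunctional_apply, ← e6, Complex.real_smul]
  generalize ((|ω|⁻¹ : ℝ) : ℂ) = D at *
  have e8 : (ω : ℂ)⁻¹ * ω = 1 := inv_mul_cancel₀ h0
  linear_combination (-Complex.I * Complex.exp (-(Complex.I * ω * v))) * e8 -
    ((ω : ℂ)⁻¹ * Complex.exp (-(Complex.I * ω * v)) * ((|ω| : ℝ) : ℂ) *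
      cosFunctional (coeff hV 0 0 v ω * rescaledJost hV v ω)) * e7

theorem bddDeriv_inv_mul_jostDeriv (hV : IsSymbol V) {v : ι → ℝ} {B : ℝ} (hv : ∀ i, |v i| ≤ B)
    {c : ℝ} (hc : 0 < c) :
    BddDeriv {ω : ℝ | c < |ω|} n fun i ω => (ω : ℂ)⁻¹ * jostDeriv V ω (v i) :=
  ((bddDeriv_exp hv).mul ((BddDeriv.const' (-Complex.I)).sub
    ((bddDeriv_comp_sign (fun σ => (σ : ℂ)) hc).mul
      (((bddDeriv_coeff hV n 0 0 hv hc).mul (bddDeriv_rescaledJost hV hv hc)).clm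
        cosFunctional)))).congr (isOpen_lt_abs c) fun i _ hω =>
      inv_mul_jostDeriv_eq hV (abs_pos.1 (hc.trans hω)) (v i)

end JostParameter

/-! ### The Regge-Wheeler potential is a symbol -/

section Potential

open Polynomial

variable {M : ℝ}

/-- The inverse radius `1 / r(u)`. -/
noncomputable def invRadius (M u : ℝ) : ℝ := (radius M u)⁻¹

theorem radius_pos (hM : 0 < M) (u : ℝ) : 0 < radius M u :=
  (by positivity : 0 < 2 * M).trans (two_mul_lt_radius hM u)

theorem invRadius_pos (hM : 0 < M) (u : ℝ) : 0 < invRadius M u :=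
  inv_pos.2 (radius_pos hM u)

theorem two_mul_mul_invRadius_lt (hM : 0 < M) (u : ℝ) : 2 * M * invRadius M u < 1 := by
  rw [invRadius, ← div_eq_mul_inv, div_lt_one (radius_pos hM u)]
  exact two_mul_lt_radius hM u

theorem strictMono_radius (hM : 0 < M) : StrictMono (radius M) := by
  intro a b hab
  by_contra! h
  have := (tortoise_strictMonoOn hM).monotoneOn (two_mul_lt_radius hM b) (two_mul_lt_radius hM a) h
  rw [tortoise_radius hM, tortoise_radius hM] at this
  exact absurd hab (not_lt.2 this)

theorem radius_tortoise (hM : 0 < M) {r : ℝ} (hr : 2 * M < r) : radius M (tortoise M r) = r :=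
  (tortoise_strictMonoOn hM).injOn (two_mul_lt_radius hM _) hr (tortoise_radius hM _)

theorem continuous_radius (hM : 0 < M) : Continuous (radius M) := by
  refine continuous_iff_continuousAt.2 fun u =>
    ((strictMono_radius hM).strictMonoOn Set.univ).continuousAt_of_image_mem_nhds univ_mem
      (mem_of_superset (Ioi_mem_nhds (two_mul_lt_radius hM u)) fun r hr => ?_)
  exact ⟨tortoise M r, Set.mem_univ _, radius_tortoise hM hr⟩

theorem hasDerivAt_radius (hM : 0 < M) (u : ℝ) :
    HasDerivAt (radius M) (1 - 2 * M * invRadius M u) u := by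
  have hr := radius_pos hM u
  have hr2 := two_mul_lt_radius hM u
  have h1 : radius M u / (2 * M) - 1 ≠ 0 := by
    have : 1 < radius M u / (2 * M) := (one_lt_div (by positivity)).2 hr2
    linarith
  have h2 : HasDerivAt (tortoise M) (1 + 2 * M * (1 / (2 * M) / (radius M u / (2 * M) - 1)))
      (radius M u) :=
    (hasDerivAt_id _).add
      (((((hasDerivAt_id (radius M u)).div_const (2 * M)).sub_const 1).log h1).const_mul (2 * M))
  have h3 : 1 + 2 * M * (1 / (2 * M) / (radius M u / (2 * M) - 1)) =
      (1 - 2 * M * invRadius M u)⁻¹ := by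
    have h4 : radius M u - 2 * M ≠ 0 := by linarith
    rw [invRadius]
    field_simp
    ring
  have h5 : 1 + 2 * M * (1 / (2 * M) / (radius M u / (2 * M) - 1)) ≠ 0 := by
    rw [h3]
    have := two_mul_mul_invRadius_lt hM u
    exact inv_ne_zero (by linarith)
  refine (HasDerivAt.of_local_left_inverse (continuous_radius hM).continuousAt h2 h5
    (Eventually.of_forall (tortoise_radius hM))).congr_deriv ?_
  rw [h3, inv_inv]

theorem hasDerivAt_invRadius (hM : 0 < M) (u : ℝ) :
    HasDerivAt (invRadius M) (-(invRadius M u ^ 2 * (1 - 2 * M * invRadius M u))) u := by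
  refine ((hasDerivAt_radius hM u).inv (radius_pos hM u).ne').congr_deriv ?_
  simp only [invRadius]
  field_simp

/-- The polynomials `R_j` for which the `j`-th derivative of the potential is
`z^(3 + j) (1 - 2Mz) R_j(z)` with `z = 1 / r`. -/
noncomputable def potentialPoly (M : ℝ) : ℕ → ℝ[X]
  | 0 => C (2 * M)
  | j + 1 => -((C ((3 + j : ℕ) : ℝ) * (1 - C (2 * M) * X) - C (2 * M) * X) * potentialPoly M j +
      X * (1 - C (2 * M) * X) * derivative (potentialPoly M j))

theorem hasDerivAt_potentialPoly (hM : 0 < M) (j : ℕ) (u : ℝ) :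
    HasDerivAt (fun u => invRadius M u ^ (3 + j) * (1 - 2 * M * invRadius M u) *
        (potentialPoly M j).eval (invRadius M u))
      (invRadius M u ^ (3 + (j + 1)) * (1 - 2 * M * invRadius M u) *
        (potentialPoly M (j + 1)).eval (invRadius M u)) u := by
  have hz := hasDerivAt_invRadius hM u
  have h1 := (hz.pow (3 + j)).mul ((hz.const_mul (2 * M)).const_sub 1)
  refine (h1.mul (((potentialPoly M j).hasDerivAt (invRadius M u)).comp u hz)).congr_deriv ?_
  have e : 3 + j - 1 = j + 2 := by omega
  simp only [potentialPoly, eval_neg, eval_add, eval_mul, eval_sub, eval_one, eval_C, eval_X,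
    Function.comp_apply, Pi.pow_apply, Pi.mul_apply, e]
  ring

theorem iteratedDeriv_potential (hM : 0 < M) (j : ℕ) :
    iteratedDeriv j (potential M) = fun u => invRadius M u ^ (3 + j) *
      (1 - 2 * M * invRadius M u) * (potentialPoly M j).eval (invRadius M u) := by
  induction j with
  | zero =>
    ext u
    simp only [iteratedDeriv_zero, potential, potentialPoly, eval_C, invRadius]
    ring
  | succ j ih =>
    ext u
    rw [iteratedDeriv_succ, ih]
    exact (hasDerivAt_potentialPoly hM j u).deriv

theorem contDiff_potential (hM : 0 < M) :
    ContDiff ℝ ((⊤ : ℕ∞) : WithTop ℕ∞) (potential M) := by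
  refine contDiff_of_differentiable_iteratedDeriv fun j _ => ?_
  rw [iteratedDeriv_potential hM]
  exact fun u => (hasDerivAt_potentialPoly hM j u).differentiableAt

/-- At `u → +∞` the inverse radius decays like `1 / u`. -/
theorem one_add_mul_invRadius_le (hM : 0 < M) {u : ℝ} (hu : 0 ≤ u) :
    (1 + |u|) * invRadius M u ≤ (2 * M)⁻¹ + 2 := by
  have hr := radius_pos hM u
  have hr2 := two_mul_lt_radius hM u
  have h1 : u ≤ 2 * radius M u := by
    have h := tortoise_radius hM u
    have hx : 0 < radius M u / (2 * M) - 1 := by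
      have : 1 < radius M u / (2 * M) := (one_lt_div (by positivity)).2 hr2
      linarith
    have hl := mul_le_mul_of_nonneg_left (Real.log_le_sub_one_of_pos hx)
      (by positivity : 0 ≤ 2 * M)
    have e : 2 * M * (radius M u / (2 * M) - 1 - 1) = radius M u - 4 * M := by
      field_simp
      ring
    rw [e] at hl
    simp only [tortoise] at h
    linarith
  rw [abs_of_nonneg hu, invRadius, add_mul, one_mul]
  refine add_le_add (inv_anti₀ (by positivity) hr2.le) ?_
  rw [← div_eq_mul_inv, div_le_iff₀ hr]
  exact h1

/-- At `u → -∞` the factor `1 - 2M / r` decays exponentially. -/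
theorem one_sub_le_exp (hM : 0 < M) (u : ℝ) :
    1 - 2 * M * invRadius M u ≤ Real.exp (u / (2 * M)) := by
  have hr := radius_pos hM u
  have hr2 := two_mul_lt_radius hM u
  have hx : 0 < radius M u / (2 * M) - 1 := by
    have : 1 < radius M u / (2 * M) := (one_lt_div (by positivity)).2 hr2
    linarith
  have h := tortoise_radius hM u
  have h1 : u / (2 * M) = radius M u / (2 * M) + Real.log (radius M u / (2 * M) - 1) := by
    nth_rw 1 [← h]
    rw [tortoise]
    field_simp
  rw [h1, Real.exp_add, Real.exp_log hx]
  have h2 : 1 - 2 * M * invRadius M u ≤ radius M u / (2 * M) - 1 := by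
    rw [invRadius]
    have e : radius M u / (2 * M) - 1 - (1 - 2 * M * (radius M u)⁻¹) =
        (radius M u - 2 * M) ^ 2 / (2 * M * radius M u) := by
      field_simp
    have : 0 ≤ (radius M u - 2 * M) ^ 2 / (2 * M * radius M u) := by positivity
    linarith
  refine h2.trans (le_mul_of_one_le_left hx.le (Real.one_le_exp (by positivity)))

theorem exists_pow_mul_exp_le {a : ℝ} (ha : 0 < a) (n : ℕ) :
    ∃ C, ∀ t : ℝ, 0 ≤ t → (1 + t) ^ n * Real.exp (-(t / a)) ≤ C := by
  refine ⟨a ^ n * n.factorial * Real.exp (1 / a), fun t ht => ?_⟩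
  have h := Real.pow_div_factorial_le_exp ((1 + t) / a) (by positivity) n
  rw [div_le_iff₀ (by positivity), div_pow, div_le_iff₀ (by positivity), add_div,
    Real.exp_add] at h
  rw [Real.exp_neg, ← div_eq_mul_inv, div_le_iff₀ (Real.exp_pos _)]
  linarith

theorem isSymbol_potential (hM : 0 < M) : IsSymbol (potential M) where
  contDiff := contDiff_potential hM
  bound := fun j => by
    obtain ⟨B, hB⟩ := (isCompact_Icc (a := (0 : ℝ)) (b := (2 * M)⁻¹)).exists_bound_of_continuousOn
      (potentialPoly M j).continuous.continuousOn
    obtain ⟨D, hD⟩ := exists_pow_mul_exp_le (by positivity : 0 < 2 * M) (j + 2)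
    have hz : ∀ u, invRadius M u ≤ (2 * M)⁻¹ := fun u =>
      inv_anti₀ (by positivity) (two_mul_lt_radius hM u).le
    have hB0 : 0 ≤ B := (norm_nonneg _).trans (hB 0 ⟨le_rfl, by positivity⟩)
    have hD0 : 0 ≤ D := le_trans (by positivity) (hD 0 le_rfl)
    refine ⟨max (((2 * M)⁻¹ + 2) ^ (j + 2) * (2 * M)⁻¹ * B) ((2 * M)⁻¹ ^ (3 + j) * D * B),
      fun u => ?_⟩
    have hz0 := (invRadius_pos hM u).le
    have hf : 0 ≤ 1 - 2 * M * invRadius M u := by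
      linarith [two_mul_mul_invRadius_lt hM u]
    have hf1 : 1 - 2 * M * invRadius M u ≤ 1 := by
      have := mul_nonneg (by positivity : 0 ≤ 2 * M) hz0
      linarith
    have hP := hB (invRadius M u) ⟨hz0, hz u⟩
    rw [Real.norm_eq_abs] at hP
    rw [iteratedDeriv_potential hM, abs_mul, abs_mul, abs_of_nonneg hf,
      abs_of_nonneg (pow_nonneg hz0 _)]
    have hz' := hz u
    rcases le_total 0 u with hu | hu
    · refine le_max_of_le_left ?_
      have h1 := one_add_mul_invRadius_le hM hu
      calc _ = ((1 + |u|) * invRadius M u) ^ (j + 2) * (invRadius M u *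
            (1 - 2 * M * invRadius M u)) * |(potentialPoly M j).eval (invRadius M u)| := by
            rw [mul_pow]
            ring
        _ ≤ ((2 * M)⁻¹ + 2) ^ (j + 2) * ((2 * M)⁻¹ * 1) * B := by gcongr
        _ = _ := by ring
    · refine le_max_of_le_right ?_
      have h1 := one_sub_le_exp hM u
      have h2 := hD |u| (abs_nonneg u)
      rw [abs_of_nonpos hu, neg_div, neg_neg] at h2
      rw [abs_of_nonpos hu]
      calc _ = invRadius M u ^ (3 + j) * ((1 + -u) ^ (j + 2) * (1 - 2 * M * invRadius M u)) *
            |(potentialPoly M j).eval (invRadius M u)| := by ring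
        _ ≤ (2 * M)⁻¹ ^ (3 + j) * ((1 + -u) ^ (j + 2) * Real.exp (u / (2 * M))) * B := by
            have : 0 ≤ 1 + -u := by linarith
            gcongr
        _ ≤ _ := by gcongr

end Potential

/-! ### The two Jost solutions and their Wronskian -/

section Solutions

variable {M : ℝ}

theorem graveIter_eq_jostIter (M : ℝ) (ω : ℂ) (k : ℕ) :
    graveIter M ω k = jostIter (potential M) ω k := by
  induction k with
  | zero => rfl
  | succ k ih =>
    ext u
    rw [graveIter, jostIter, ih]

theorem acuteIter_eq_jostIter (M : ℝ) (ω : ℂ) (k : ℕ) (u : ℝ) :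
    acuteIter M ω k u = jostIter (fun t => potential M (-t)) ω k (-u) := by
  induction k generalizing u with
  | zero =>
    rw [acuteIter, jostIter]
    push_cast
    congr 1
    ring
  | succ k ih =>
    rw [acuteIter, jostIter, ← integral_neg, ← integral_comp_neg_Iic]
    refine setIntegral_congr_fun measurableSet_Iic fun v _ => ?_
    simp only [ih, neg_neg]
    have : ω * ((-u : ℝ) - (-v : ℝ) : ℂ) = -(ω * (u - v)) := by
      push_cast
      ring
    rw [this, Complex.sin_neg]
    ring

theorem grave_eq_jost (M ω : ℝ) : grave M ω = jost (potential M) ω := by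
  ext u
  simp only [grave, jost, graveIter_eq_jostIter]

theorem acute_eq_jost (M ω u : ℝ) : acute M ω u = jost (fun t => potential M (-t)) ω (-u) := by
  simp only [acute, jost, acuteIter_eq_jostIter]

/-- The derivative of `grave`. -/
noncomputable def graveDeriv (M ω u : ℝ) : ℂ := jostDeriv (potential M) ω u

/-- The derivative of `acute`. -/
noncomputable def acuteDeriv (M ω u : ℝ) : ℂ := -jostDeriv (fun t => potential M (-t)) ω (-u)

/-- `φ` solves the Schrödinger equation of frequency `ω` with potential `V`, and `φ'` is its
derivative. -/
structure IsSolution (V : ℝ → ℝ) (ω : ℝ) (φ φ' : ℝ → ℂ) : Prop where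
  hasDerivAt : ∀ x, HasDerivAt φ (φ' x) x
  hasDerivAt' : ∀ x, HasDerivAt φ' ((-(ω : ℂ) ^ 2 + V x) * φ x) x

theorem isSolution_grave (hM : 0 < M) {ω : ℝ} (hω : ω ≠ 0) :
    IsSolution (potential M) ω (grave M ω) (graveDeriv M ω) where
  hasDerivAt := fun x => by
    rw [grave_eq_jost]
    exact hasDerivAt_jost (isSymbol_potential hM) hω x
  hasDerivAt' := fun x => by
    rw [grave_eq_jost]
    exact hasDerivAt_jostDeriv (isSymbol_potential hM) hω x

theorem isSolution_acute (hM : 0 < M) {ω : ℝ} (hω : ω ≠ 0) :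
    IsSolution (potential M) ω (acute M ω) (acuteDeriv M ω) where
  hasDerivAt := fun x => by
    rw [funext (acute_eq_jost M ω)]
    refine ((hasDerivAt_jost (isSymbol_potential hM).comp_neg hω (-x)).scomp x
      (hasDerivAt_neg x)).congr_deriv ?_
    simp [acuteDeriv]
  hasDerivAt' := fun x => by
    rw [acute_eq_jost]
    refine (((hasDerivAt_jostDeriv (isSymbol_potential hM).comp_neg hω (-x)).scomp x
      (hasDerivAt_neg x)).neg).congr_deriv ?_
    simp

namespace IsSolution

variable {V : ℝ → ℝ} {ω : ℝ} {φ φ' ψ ψ' : ℝ → ℂ}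

theorem deriv_eq (h : IsSolution V ω φ φ') : deriv φ = φ' := funext fun x => (h.hasDerivAt x).deriv

theorem continuous (h : IsSolution V ω φ φ') : Continuous φ :=
  continuous_iff_continuousAt.2 fun x => (h.hasDerivAt x).continuousAt

theorem contDiff (h : IsSolution V ω φ φ') (hV : Continuous V) : ContDiff ℝ 2 φ := by
  have h' : ContDiff ℝ 1 φ' := by
    refine contDiff_one_iff_deriv.2 ⟨fun x => (h.hasDerivAt' x).differentiableAt, ?_⟩
    rw [funext fun x => (h.hasDerivAt' x).deriv]
    exact (continuous_const.add (Complex.continuous_ofReal.comp hV)).mul h.continuous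
  have : ContDiff ℝ (1 + 1) φ := contDiff_succ_iff_deriv.2
    ⟨fun x => (h.hasDerivAt x).differentiableAt, by simp, by rwa [h.deriv_eq]⟩
  simpa [one_add_one_eq_two] using this

theorem solvesSchrodinger {M : ℝ} (h : IsSolution (potential M) ω φ φ')
    (hV : Continuous (potential M)) : SolvesSchrodinger M ω φ := by
  refine ⟨h.contDiff hV, fun x => ?_⟩
  rw [h.deriv_eq, (h.hasDerivAt' x).deriv]
  ring

theorem conj (h : IsSolution V ω φ φ') :
    IsSolution V ω (fun x => starRingEnd ℂ (φ x)) fun x => starRingEnd ℂ (φ' x) where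
  hasDerivAt := fun x => Complex.conjCLE.hasFDerivAt.comp_hasDerivAt x (h.hasDerivAt x)
  hasDerivAt' := fun x => by
    refine (Complex.conjCLE.hasFDerivAt.comp_hasDerivAt x (h.hasDerivAt' x)).congr_deriv ?_
    simp

/-- The Wronskian of two solutions is constant. -/
theorem wronskian_const (h : IsSolution V ω φ φ') (k : IsSolution V ω ψ ψ') (x y : ℝ) :
    φ x * ψ' x - φ' x * ψ x = φ y * ψ' y - φ' y * ψ y := by
  have hd : ∀ x, HasDerivAt (fun x => φ x * ψ' x - φ' x * ψ x) 0 x := fun x => by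
    refine (((h.hasDerivAt x).mul (k.hasDerivAt' x)).sub
      ((h.hasDerivAt' x).mul (k.hasDerivAt x))).congr_deriv ?_
    ring
  exact is_const_of_deriv_eq_zero (fun x => (hd x).differentiableAt) (fun x => (hd x).deriv) x y

end IsSolution

theorem norm_exp_I_mul (a b : ℝ) : ‖Complex.exp (Complex.I * a * b)‖ = 1 := by
  have h := norm_exp_neg_I_mul (-a) b
  push_cast at h
  rwa [mul_neg, neg_mul, neg_neg] at h

section Asymptotics

variable {φ φ' : ℝ → ℂ} {l : Filter ℝ} {a : ℝ}

theorem tendsto_exp_mul_of_sub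
    (h : Tendsto (fun x : ℝ => φ x - Complex.exp (-(Complex.I * a * x))) l (𝓝 0)) :
    Tendsto (fun x : ℝ => Complex.exp (Complex.I * a * x) * φ x) l (𝓝 1) := by
  refine tendsto_sub_nhds_zero_iff.1 (squeeze_zero_norm (fun x => le_of_eq ?_)
    (tendsto_norm_zero.comp h))
  rw [Function.comp_apply, ← one_mul ‖φ x - _‖, ← norm_exp_I_mul a x, ← norm_mul, mul_sub,
    ← Complex.exp_add, add_neg_cancel, Complex.exp_zero]

theorem tendsto_exp_mul_of_add
    (h : Tendsto (fun x : ℝ => φ' x + Complex.I * a * Complex.exp (-(Complex.I * a * x))) l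
      (𝓝 0)) :
    Tendsto (fun x : ℝ => Complex.exp (Complex.I * a * x) * φ' x) l (𝓝 (-(Complex.I * a))) := by
  refine tendsto_sub_nhds_zero_iff.1 (squeeze_zero_norm (fun x => le_of_eq ?_)
    (tendsto_norm_zero.comp h))
  rw [Function.comp_apply, ← one_mul ‖φ' x + _‖, ← norm_exp_I_mul a x, ← norm_mul, mul_add,
    mul_left_comm, ← Complex.exp_add, add_neg_cancel, Complex.exp_zero, mul_one, sub_neg_eq_add]

theorem tendsto_deriv_exp_mul (hd : ∀ x, HasDerivAt φ (φ' x) x)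
    (h : Tendsto (fun x : ℝ => φ x - Complex.exp (-(Complex.I * a * x))) l (𝓝 0))
    (h' : Tendsto (fun x : ℝ => φ' x + Complex.I * a * Complex.exp (-(Complex.I * a * x))) l
      (𝓝 0)) :
    Tendsto (deriv fun x : ℝ => Complex.exp (Complex.I * a * x) * φ x) l (𝓝 0) := by
  have e : (deriv fun x : ℝ => Complex.exp (Complex.I * a * x) * φ x) = fun x : ℝ =>
      Complex.I * a * (Complex.exp (Complex.I * a * x) * φ x) +
        Complex.exp (Complex.I * a * x) * φ' x := by
    ext x
    have he := hasDerivAt_exp_neg_I_mul (-a) x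
    simp only [Complex.ofReal_neg, mul_neg, neg_mul, neg_neg] at he
    refine (he.mul (hd x)).deriv.trans ?_
    ring
  rw [e]
  have := ((tendsto_exp_mul_of_sub h).const_mul (Complex.I * a)).add (tendsto_exp_mul_of_add h')
  simpa using this

/-- The Wronskian of a solution asymptotic to `exp (-iax)` with its complex conjugate. -/
theorem wronskian_conj_eq {V : ℝ → ℝ} {ω : ℝ} [l.NeBot] (hs : IsSolution V ω φ φ')
    (h : Tendsto (fun x : ℝ => φ x - Complex.exp (-(Complex.I * a * x))) l (𝓝 0))
    (h' : Tendsto (fun x : ℝ => φ' x + Complex.I * a * Complex.exp (-(Complex.I * a * x))) l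
      (𝓝 0)) (x : ℝ) :
    φ x * starRingEnd ℂ (φ' x) - φ' x * starRingEnd ℂ (φ x) = 2 * Complex.I * a := by
  have h1 := tendsto_exp_mul_of_sub h
  have h2 := tendsto_exp_mul_of_add h'
  have c1 := (Complex.continuous_conj.tendsto _).comp h1
  have c2 := (Complex.continuous_conj.tendsto _).comp h2
  have ht := (h1.mul c2).sub (h2.mul c1)
  -- the phases cancel, so that the constant Wronskian is computed from the limits of
  -- `exp (iax) φ` and `exp (iax) φ'`
  have hconst : ∀ y : ℝ, Complex.exp (Complex.I * a * y) * φ y *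
        starRingEnd ℂ (Complex.exp (Complex.I * a * y) * φ' y) -
      Complex.exp (Complex.I * a * y) * φ' y *
        starRingEnd ℂ (Complex.exp (Complex.I * a * y) * φ y) =
      φ x * starRingEnd ℂ (φ' x) - φ' x * starRingEnd ℂ (φ x) := by
    intro y
    have hn : Complex.exp (Complex.I * a * y) * starRingEnd ℂ (Complex.exp (Complex.I * a * y)) =
        1 := by
      rw [Complex.mul_conj', norm_exp_I_mul]
      simp
    rw [hs.wronskian_const hs.conj x y, map_mul, map_mul]
    linear_combination (φ y * starRingEnd ℂ (φ' y) - φ' y * starRingEnd ℂ (φ y)) * hn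
  simp only [Function.comp_def, hconst] at ht
  have := tendsto_nhds_unique tendsto_const_nhds ht
  rw [this]
  simp
  ring

end Asymptotics

theorem tendsto_grave (hM : 0 < M) {ω : ℝ} (hω : ω ≠ 0) :
    Tendsto (fun x : ℝ => grave M ω x - Complex.exp (-(Complex.I * ω * x))) atTop (𝓝 0) := by
  rw [grave_eq_jost]
  exact tendsto_jost_sub (isSymbol_potential hM) hω

theorem tendsto_graveDeriv (hM : 0 < M) {ω : ℝ} (hω : ω ≠ 0) :
    Tendsto (fun x : ℝ => graveDeriv M ω x +
      Complex.I * ω * Complex.exp (-(Complex.I * ω * x))) atTop (𝓝 0) :=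
  tendsto_jostDeriv_add (isSymbol_potential hM) hω

theorem tendsto_acute (hM : 0 < M) {ω : ℝ} (hω : ω ≠ 0) :
    Tendsto (fun x : ℝ => acute M ω x - Complex.exp (-(Complex.I * (-ω : ℝ) * x))) atBot
      (𝓝 0) := by
  refine ((tendsto_jost_sub (isSymbol_potential hM).comp_neg hω).comp
    tendsto_neg_atBot_atTop).congr fun x => ?_
  rw [Function.comp_apply, acute_eq_jost]
  push_cast
  ring_nf

theorem tendsto_acuteDeriv (hM : 0 < M) {ω : ℝ} (hω : ω ≠ 0) :
    Tendsto (fun x : ℝ => acuteDeriv M ω x +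
      Complex.I * (-ω : ℝ) * Complex.exp (-(Complex.I * (-ω : ℝ) * x))) atBot (𝓝 0) := by
  have h := ((tendsto_jostDeriv_add (isSymbol_potential hM).comp_neg hω).comp
    tendsto_neg_atBot_atTop).neg
  rw [neg_zero] at h
  refine h.congr fun x => ?_
  rw [Function.comp_apply, acuteDeriv]
  push_cast
  ring_nf

theorem isGraveSolution_grave (hM : 0 < M) {ω : ℝ} (hω : ω ≠ 0) :
    IsGraveSolution M ω (grave M ω) :=
  ⟨(isSolution_grave hM hω).solvesSchrodinger (contDiff_potential hM).continuous,
    tendsto_exp_mul_of_sub (tendsto_grave hM hω),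
    tendsto_deriv_exp_mul (isSolution_grave hM hω).hasDerivAt (tendsto_grave hM hω)
      (tendsto_graveDeriv hM hω)⟩

theorem isAcuteSolution_acute (hM : 0 < M) {ω : ℝ} (hω : ω ≠ 0) :
    IsAcuteSolution M ω (acute M ω) := by
  have h1 := tendsto_exp_mul_of_sub (tendsto_acute hM hω)
  have h2 := tendsto_deriv_exp_mul (isSolution_acute hM hω).hasDerivAt (tendsto_acute hM hω)
      (tendsto_acuteDeriv hM hω)
  simp only [Complex.ofReal_neg, mul_neg, neg_mul] at h1 h2
  exact ⟨(isSolution_acute hM hω).solvesSchrodinger (contDiff_potential hM).continuous, h1, h2⟩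

theorem wronskian_acute_grave (hM : 0 < M) {ω : ℝ} (hω : ω ≠ 0) (x : ℝ) :
    wronskian (acute M ω) (grave M ω) x =
      acute M ω x * graveDeriv M ω x - acuteDeriv M ω x * grave M ω x := by
  rw [wronskian, (isSolution_acute hM hω).deriv_eq, (isSolution_grave hM hω).deriv_eq]

/-- The lower bound `|w| ≥ 2|ω|` (the transmission coefficient is at most `1`). It follows from
the Plücker identity `|w|² = w(φ, φ̄) w(ψ, ψ̄) + |w(φ, ψ̄)|²` for the Wronskians of `φ`, `ψ` and
their conjugates, in which the first product equals `4ω²`. -/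
theorem two_mul_abs_le_norm_wronskian (hM : 0 < M) {ω : ℝ} (hω : ω ≠ 0) (x : ℝ) :
    2 * |ω| ≤ ‖wronskian (acute M ω) (grave M ω) x‖ := by
  rw [wronskian_acute_grave hM hω]
  have h1 := wronskian_conj_eq (isSolution_acute hM hω) (tendsto_acute hM hω)
    (tendsto_acuteDeriv hM hω) x
  have h2 := wronskian_conj_eq (isSolution_grave hM hω) (tendsto_grave hM hω)
    (tendsto_graveDeriv hM hω) x
  generalize acute M ω x = a at *
  generalize acuteDeriv M ω x = a' at *
  generalize grave M ω x = b at *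
  generalize graveDeriv M ω x = b' at *
  have key : ((‖a * b' - a' * b‖ ^ 2 : ℝ) : ℂ) = ((4 * ω ^ 2 +
      ‖a * starRingEnd ℂ b' - a' * starRingEnd ℂ b‖ ^ 2 : ℝ) : ℂ) := by
    push_cast
    rw [← Complex.mul_conj', ← Complex.mul_conj']
    simp only [map_sub, map_mul, Complex.conj_conj]
    push_cast at h1
    linear_combination (b * starRingEnd ℂ b' - b' * starRingEnd ℂ b) * h1 -
      2 * Complex.I * ω * h2 - 4 * (ω : ℂ) ^ 2 * Complex.I_sq
  have key' := Complex.ofReal_injective key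
  refine abs_le_of_sq_le_sq' (a := 2 * |ω|) ?_ (norm_nonneg _) |>.2
  rw [key', mul_pow, sq_abs]
  nlinarith [sq_nonneg ‖a * starRingEnd ℂ b' - a' * starRingEnd ℂ b‖]

theorem wronskian_ne_zero (hM : 0 < M) {ω : ℝ} (hω : ω ≠ 0) (x : ℝ) :
    wronskian (acute M ω) (grave M ω) x ≠ 0 := by
  have h := two_mul_abs_le_norm_wronskian hM hω x
  have := abs_pos.2 hω
  exact norm_pos_iff.1 (by linarith)

end Solutions

/-! ### The kernel -/

section Kernel

variable {M : ℝ} {ι : Type*} {n : ℕ}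

theorem bddDeriv_grave (hM : 0 < M) {v : ι → ℝ} {B : ℝ} (hv : ∀ i, |v i| ≤ B) {c : ℝ}
    (hc : 0 < c) : BddDeriv {ω : ℝ | c < |ω|} n fun i ω => grave M ω (v i) := by
  simp only [grave_eq_jost]
  exact bddDeriv_jost (isSymbol_potential hM) hv hc

theorem bddDeriv_acute (hM : 0 < M) {v : ι → ℝ} {B : ℝ} (hv : ∀ i, |v i| ≤ B) {c : ℝ}
    (hc : 0 < c) : BddDeriv {ω : ℝ | c < |ω|} n fun i ω => acute M ω (v i) := by
  simp only [acute_eq_jost]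
  exact bddDeriv_jost (isSymbol_potential hM).comp_neg (v := fun i => -v i)
    (fun i => (abs_neg (v i)).trans_le (hv i)) hc

theorem bddDeriv_inv_mul_graveDeriv (hM : 0 < M) {v : ι → ℝ} {B : ℝ} (hv : ∀ i, |v i| ≤ B)
    {c : ℝ} (hc : 0 < c) :
    BddDeriv {ω : ℝ | c < |ω|} n fun i ω => (ω : ℂ)⁻¹ * graveDeriv M ω (v i) :=
  bddDeriv_inv_mul_jostDeriv (isSymbol_potential hM) hv hc

theorem bddDeriv_inv_mul_acuteDeriv (hM : 0 < M) {v : ι → ℝ} {B : ℝ} (hv : ∀ i, |v i| ≤ B)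
    {c : ℝ} (hc : 0 < c) :
    BddDeriv {ω : ℝ | c < |ω|} n fun i ω => (ω : ℂ)⁻¹ * acuteDeriv M ω (v i) := by
  have := (bddDeriv_inv_mul_jostDeriv (n := n) (isSymbol_potential hM).comp_neg
    (v := fun i => -v i) (fun i => (abs_neg (v i)).trans_le (hv i)) hc).neg
  simpa only [acuteDeriv, mul_neg] using this

theorem bddDeriv_wronskian (hM : 0 < M) (u : ℝ) {c : ℝ} (hc : 0 < c) :
    BddDeriv {ω : ℝ | c < |ω|} n fun (_ : ι) ω =>
      (ω : ℂ)⁻¹ * wronskian (acute M ω) (grave M ω) u := by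
  have hu : ∀ _ : ι, |u| ≤ |u| := fun _ => le_rfl
  refine (((bddDeriv_acute hM hu hc).mul (bddDeriv_inv_mul_graveDeriv hM hu hc)).sub
    ((bddDeriv_inv_mul_acuteDeriv hM hu hc).mul (bddDeriv_grave hM hu hc))).congr
      (isOpen_lt_abs c) fun _ ω hω => ?_
  rw [wronskian_acute_grave hM (abs_pos.1 (hc.trans hω))]
  ring

/-- Both the Wronskian and the derivatives of the Jost solutions are divided by `ω`, which leaves
bounded quantities, and `w / ω` stays away from `0`. -/
theorem bddDeriv_kernel (hM : 0 < M) (u : ℝ) {v : ι → ℝ} {B : ℝ} (hv : ∀ i, |v i| ≤ B)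
    {c : ℝ} (hc : 0 < c) :
    BddDeriv {ω : ℝ | c < |ω|} n fun i ω => (kernel M ω u (v i) : ℂ) := by
  have hu : ∀ _ : ι, |u| ≤ |u| := fun _ => le_rfl
  have hw := (bddDeriv_wronskian (ι := ι) (n := n) hM u hc).inv (isOpen_lt_abs c) two_pos
    fun _ ω hω => by
      have hω' : 0 < |ω| := hc.trans hω
      rw [norm_mul, norm_inv, Complex.norm_real, Real.norm_eq_abs, inv_mul_eq_div,
        le_div_iff₀ hω']
      exact two_mul_abs_le_norm_wronskian hM (abs_pos.1 hω') u
  refine ((((((bddDeriv_acute hM hu hc).mul (bddDeriv_grave hM hv hc)).mul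
    (bddDeriv_inv hc)).mul hw).clm Complex.imCLM).clm Complex.ofRealCLM).congr
      (isOpen_lt_abs c) fun i ω hω => ?_
  have h0 : (ω : ℂ) ≠ 0 := by exact_mod_cast abs_pos.1 (hc.trans hω)
  rw [kernel, Complex.ofRealCLM_apply, Complex.imCLM_apply]
  congr 2
  rw [mul_inv, inv_inv, div_eq_mul_inv, mul_assoc, mul_assoc, ← mul_assoc (ω : ℂ)⁻¹,
    inv_mul_cancel₀ h0, one_mul]
  ring

/-- The derivative of the kernel with respect to its last argument. -/
noncomputable def kernelDeriv (M ω u v : ℝ) : ℝ :=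
  (acute M ω u * graveDeriv M ω v / wronskian (acute M ω) (grave M ω) u).im

theorem hasDerivAt_kernel (hM : 0 < M) {ω : ℝ} (hω : ω ≠ 0) (u v : ℝ) :
    HasDerivAt (fun v => (kernel M ω u v : ℂ)) (kernelDeriv M ω u v) v :=
  (Complex.imCLM.hasFDerivAt.comp_hasDerivAt v
    ((((isSolution_grave hM hω).hasDerivAt v).const_mul _).div_const _)).ofReal_comp

theorem hasDerivAt_kernelDeriv (hM : 0 < M) {ω : ℝ} (hω : ω ≠ 0) (u v : ℝ) :
    HasDerivAt (fun v => (kernelDeriv M ω u v : ℂ))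
      ((-(ω : ℂ) ^ 2 + potential M v) * kernel M ω u v) v := by
  refine (Complex.imCLM.hasFDerivAt.comp_hasDerivAt v
    ((((isSolution_grave hM hω).hasDerivAt' v).const_mul _).div_const _)).ofReal_comp.congr_deriv ?_
  have e : acute M ω u * ((-(ω : ℂ) ^ 2 + potential M v) * grave M ω v) /
      wronskian (acute M ω) (grave M ω) u = ((-ω ^ 2 + potential M v : ℝ) : ℂ) *
        (acute M ω u * grave M ω v / wronskian (acute M ω) (grave M ω) u) := by
    push_cast
    ring
  rw [e, Complex.imCLM_apply, Complex.im_ofReal_mul, kernel]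
  push_cast
  ring

theorem continuous_kernel (hM : 0 < M) {ω : ℝ} (hω : ω ≠ 0) (u : ℝ) :
    Continuous fun v => (kernel M ω u v : ℂ) :=
  continuous_iff_continuousAt.2 fun v => (hasDerivAt_kernel hM hω u v).continuousAt

theorem continuous_kernelDeriv (hM : 0 < M) {ω : ℝ} (hω : ω ≠ 0) (u : ℝ) :
    Continuous fun v => (kernelDeriv M ω u v : ℂ) :=
  continuous_iff_continuousAt.2 fun v => (hasDerivAt_kernelDeriv hM hω u v).continuousAt

end Kernel

/-! ### Pairing with test functions -/

section Pairing

variable {M : ℝ} {n : ℕ} {Ψ : ℝ → ℂ}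

/-- The integral of the kernel against a test function. -/
noncomputable def pairing (M u : ℝ) (Ψ : ℝ → ℂ) (ω : ℝ) : ℂ := ∫ v, (kernel M ω u v : ℂ) * Ψ v

theorem bddDeriv_pairing (hM : 0 < M) (u : ℝ) (hΨ : Continuous Ψ) (hs : HasCompactSupport Ψ)
    {c : ℝ} (hc : 0 < c) :
    BddDeriv {ω : ℝ | c < |ω|} n fun (_ : Unit) ω => pairing M u Ψ ω := by
  obtain ⟨B, hB⟩ := hs.isCompact.isBounded.subset_closedBall 0
  have hB' : ∀ v, v ∉ Set.Icc (-B) B → Ψ v = 0 := fun v hv => by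
    by_contra h
    refine hv (abs_le.1 ?_)
    simpa using hB (subset_tsupport Ψ h)
  obtain ⟨D, hD⟩ := hΨ.bounded_above_of_compact_support hs
  let μ : Measure (Set.Icc (-B) B) := Measure.comap Subtype.val volume
  have hfin : IsFiniteMeasure μ :=
    ⟨by
      rw [comap_subtype_coe_apply measurableSet_Icc, Set.image_univ, Subtype.range_coe]
      exact measure_Icc_lt_top⟩
  have h1 : BddDeriv {ω : ℝ | c < |ω|} n fun (v : Set.Icc (-B) B) ω =>
      (kernel M ω u v : ℂ) * Ψ v :=
    (bddDeriv_kernel hM u (fun v : Set.Icc (-B) B => abs_le.2 v.2) hc).mul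
      (BddDeriv.const (C := D) fun v => hD v)
  refine (h1.integral (μ := μ) (isOpen_lt_abs c) fun ω hω => ?_).congr (isOpen_lt_abs c)
    fun _ ω hω => ?_
  · exact ((((continuous_kernel hM (abs_pos.1 (hc.trans hω)) u).mul hΨ).comp
      continuous_subtype_val).aestronglyMeasurable)
  · rw [integral_subtype_comap measurableSet_Icc fun v => (kernel M ω u v : ℂ) * Ψ v, pairing]
    exact (setIntegral_eq_integral_of_forall_compl_eq_zero fun v hv => by
      rw [hB' v hv, mul_zero]).symm

/-- The operator `-∂² + V₀`. -/
noncomputable def schrodingerOp (M : ℝ) (Ψ : ℝ → ℂ) (v : ℝ) : ℂ :=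
  potential M v * Ψ v - deriv (deriv Ψ) v

theorem contDiff_schrodingerOp (hM : 0 < M) (hΨ : ContDiff ℝ ((⊤ : ℕ∞) : WithTop ℕ∞) Ψ) :
    ContDiff ℝ ((⊤ : ℕ∞) : WithTop ℕ∞) (schrodingerOp M Ψ) :=
  ((Complex.ofRealCLM.contDiff.comp (contDiff_potential hM)).mul hΨ).sub
    (contDiff_infty_iff_deriv.1 (contDiff_infty_iff_deriv.1 hΨ).2).2

theorem hasCompactSupport_schrodingerOp (hs : HasCompactSupport Ψ) :
    HasCompactSupport (schrodingerOp M Ψ) :=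
  (hs.mul_left (f := fun v => (potential M v : ℂ))).sub hs.deriv.deriv

/-- Integration by parts: since the kernel solves the Schrödinger equation in `v` for all `v`,
no boundary terms arise and `ω²` is traded for derivatives of the test function. -/
theorem pairing_schrodingerOp (hM : 0 < M) (u : ℝ) (hΨ : ContDiff ℝ ((⊤ : ℕ∞) : WithTop ℕ∞) Ψ)
    (hs : HasCompactSupport Ψ) {ω : ℝ} (hω : ω ≠ 0) :
    pairing M u (schrodingerOp M Ψ) ω = (ω : ℂ) ^ 2 * pairing M u Ψ ω := by
  have d1 := contDiff_infty_iff_deriv.1 hΨ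
  have d2 := contDiff_infty_iff_deriv.1 d1.2
  have hV : Continuous fun v => (potential M v : ℂ) :=
    Complex.continuous_ofReal.comp (contDiff_potential hM).continuous
  have k0 := continuous_kernel hM hω u
  have k1 := continuous_kernelDeriv hM hω u
  have i0 : Integrable fun v => (kernel M ω u v : ℂ) * Ψ v :=
    (k0.mul hΨ.continuous).integrable_of_hasCompactSupport hs.mul_left
  have i1 : Integrable fun v => (kernel M ω u v : ℂ) * deriv Ψ v :=
    (k0.mul d1.2.continuous).integrable_of_hasCompactSupport hs.deriv.mul_left
  have i2 : Integrable fun v => (kernel M ω u v : ℂ) * deriv (deriv Ψ) v :=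
    (k0.mul d2.2.continuous).integrable_of_hasCompactSupport hs.deriv.deriv.mul_left
  have j0 : Integrable fun v => (kernelDeriv M ω u v : ℂ) * Ψ v :=
    (k1.mul hΨ.continuous).integrable_of_hasCompactSupport hs.mul_left
  have j1 : Integrable fun v => (kernelDeriv M ω u v : ℂ) * deriv Ψ v :=
    (k1.mul d1.2.continuous).integrable_of_hasCompactSupport hs.deriv.mul_left
  have l0 : Integrable fun v => (-(ω : ℂ) ^ 2 + potential M v) * kernel M ω u v * Ψ v :=
    (((continuous_const.add hV).mul k0).mul hΨ.continuous).integrable_of_hasCompactSupport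
      hs.mul_left
  have m0 : Integrable fun v => (kernel M ω u v : ℂ) * (potential M v * Ψ v) :=
    (k0.mul (hV.mul hΨ.continuous)).integrable_of_hasCompactSupport hs.mul_left.mul_left
  have p1 := integral_mul_deriv_eq_deriv_mul_of_integrable
    (fun v _ => hasDerivAt_kernel hM hω u v) (fun v _ => (d2.1 v).hasDerivAt) i2 j1 i1
  have p2 := integral_mul_deriv_eq_deriv_mul_of_integrable
    (fun v _ => hasDerivAt_kernelDeriv hM hω u v) (fun v _ => (d1.1 v).hasDerivAt) j1 l0 j0
  simp only [pairing, schrodingerOp, mul_sub]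
  rw [integral_sub m0 i2, p1, p2, neg_neg, ← integral_sub m0 l0, ← integral_const_mul]
  refine integral_congr_ae (Eventually.of_forall fun v => ?_)
  simp only
  ring

end Pairing

/-! ### Rapid decay -/

section Rapid

variable {E F : Type*} [NormedAddCommGroup E] [NormedSpace ℝ E] [NormedAddCommGroup F]
  [NormedSpace ℝ F]

/-- Functions which are smooth away from `0` and whose products with all powers of `ω` have bounded
derivatives away from `0`. -/
def Rapid (f : ℝ → E) : Prop :=
  ∀ c : ℝ, 0 < c → ∀ N n : ℕ,
    BddDeriv {ω : ℝ | c < |ω|} n fun (_ : Unit) ω => ω ^ N • f ω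

namespace Rapid

variable {f g : ℝ → E}

theorem congr (hf : Rapid f) (h : ∀ ω, ω ≠ 0 → g ω = f ω) : Rapid g := fun c hc N n =>
  (hf c hc N n).congr (isOpen_lt_abs c) fun _ ω hω => by rw [h ω (abs_pos.1 (hc.trans hω))]

theorem add (hf : Rapid f) (hg : Rapid g) : Rapid fun ω => f ω + g ω := fun c hc N n =>
  ((hf c hc N n).add (hg c hc N n)).congr (isOpen_lt_abs c) fun _ _ _ => smul_add _ _ _

theorem clm (L : E →L[ℝ] F) (hf : Rapid f) : Rapid fun ω => L (f ω) := fun c hc N n =>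
  ((hf c hc N n).clm L).congr (isOpen_lt_abs c) fun _ _ _ => (L.map_smul _ _).symm

theorem id_smul (hf : Rapid f) : Rapid fun ω => ω • f ω := fun c hc N n =>
  (hf c hc (N + 1) n).congr (isOpen_lt_abs c) fun _ ω _ => by rw [smul_smul, pow_succ]

theorem bddDeriv (hf : Rapid f) {c : ℝ} (hc : 0 < c) (n : ℕ) :
    BddDeriv {ω : ℝ | c < |ω|} n fun (_ : Unit) => f :=
  (hf c hc 0 n).congr (isOpen_lt_abs c) fun _ ω _ => by rw [pow_zero, one_smul]

theorem deriv (hf : Rapid f) : Rapid (deriv f) := by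
  intro c hc N n
  -- `ω ^ N f' = (ω ^ N f)' - N ω ^ (N - 1) f`, where the last term vanishes for `N = 0`
  refine (((hf c hc N (n + 1)).deriv (isOpen_lt_abs c)).sub
    ((hf c hc (N - 1) n).clm ((N : ℝ) • ContinuousLinearMap.id ℝ E))).congr (isOpen_lt_abs c)
      fun i ω hω => ?_
  have h1 := (hf.bddDeriv hc 1).hasDerivAt_deriv i hω
  have h2 := ((hasDerivAt_pow N ω).smul h1).deriv
  change _ = _root_.deriv (fun ω => ω ^ N • f ω) ω - _
  change _root_.deriv (fun ω => ω ^ N • f ω) ω = _ at h2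
  rw [h2]
  simp [smul_smul, mul_comm]

theorem iteratedDeriv (hf : Rapid f) (m : ℕ) : Rapid (iteratedDeriv m f) := by
  induction m with
  | zero => simpa only [iteratedDeriv_zero] using hf
  | succ m ih => simpa only [iteratedDeriv_succ] using ih.deriv

theorem contDiffOn (hf : Rapid f) (n : ℕ) : ContDiffOn ℝ n f {ω : ℝ | ω ≠ 0} := by
  intro ω hω
  have hc : 0 < |ω| / 2 := half_pos (abs_pos.2 hω)
  have hmem : ω ∈ {w : ℝ | |ω| / 2 < |w|} := half_lt_self (abs_pos.2 hω)
  exact (((hf.bddDeriv hc (n + 1)).contDiffOn (isOpen_lt_abs _) ()).contDiffAt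
    ((isOpen_lt_abs _).mem_nhds hmem)).contDiffWithinAt

theorem norm_le (hf : Rapid f) (N : ℕ) :
    ∃ C R : ℝ, 0 < R ∧ ∀ ω : ℝ, R ≤ |ω| → ‖f ω‖ ≤ C / |ω| ^ N := by
  obtain ⟨C, hC⟩ := (hf (1 / 2) (by norm_num) N 0).bound
  refine ⟨C, 1, one_pos, fun ω hω => ?_⟩
  have h := hC () ω (show 1 / 2 < |ω| by linarith)
  rw [norm_smul, norm_pow, Real.norm_eq_abs] at h
  rw [le_div_iff₀ (pow_pos (by linarith) N), mul_comm]
  exact h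

end Rapid

theorem rapid_pairing {M : ℝ} (hM : 0 < M) (u : ℝ) {Ψ : ℝ → ℂ}
    (hΨ : ContDiff ℝ ((⊤ : ℕ∞) : WithTop ℕ∞) Ψ) (hs : HasCompactSupport Ψ) :
    Rapid (pairing M u Ψ) := by
  intro c hc N n
  have hiter : ∀ N : ℕ, ContDiff ℝ ((⊤ : ℕ∞) : WithTop ℕ∞) ((schrodingerOp M)^[N] Ψ) ∧
      HasCompactSupport ((schrodingerOp M)^[N] Ψ) ∧ ∀ ω : ℝ, ω ≠ 0 →
        pairing M u ((schrodingerOp M)^[N] Ψ) ω = (ω : ℂ) ^ (2 * N) * pairing M u Ψ ω := by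
    intro N
    induction N with
    | zero => exact ⟨hΨ, hs, fun ω _ => by simp⟩
    | succ N ih =>
      obtain ⟨h1, h2, h3⟩ := ih
      rw [Function.iterate_succ_apply']
      refine ⟨contDiff_schrodingerOp hM h1, hasCompactSupport_schrodingerOp h2, fun ω hω => ?_⟩
      rw [pairing_schrodingerOp hM u h1 h2 hω, h3 ω hω]
      ring
  obtain ⟨h1, h2, h3⟩ := hiter N
  refine (((bddDeriv_inv hc).pow N).mul (bddDeriv_pairing hM u h1.continuous h2 hc)).congr
    (isOpen_lt_abs c) fun _ ω hω => ?_
  have hω' : ω ≠ 0 := abs_pos.1 (hc.trans hω)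
  have h0 : (ω : ℂ) ≠ 0 := by exact_mod_cast hω'
  rw [h3 ω hω', Complex.real_smul, two_mul, pow_add]
  push_cast
  rw [inv_pow]
  field_simp

end Rapid

/-! ### The spectral integrand -/

section Spectral

variable {M u : ℝ} {Ψ₀ : ℝ → Fin 2 → ℂ}

theorem continuous_density (hM : 0 < M) (hΨ : Continuous Ψ₀) {ω : ℝ} (hω : ω ≠ 0) :
    Continuous (density M u Ψ₀ ω) :=
  (continuous_kernel hM hω u).smul (Continuous.matrix_mulVec continuous_const hΨ)

theorem integrableOn_density (hM : 0 < M) (hΨ : Continuous Ψ₀) (hs : HasCompactSupport Ψ₀) {ω : ℝ}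
    (hω : ω ≠ 0) : IntegrableOn (density M u Ψ₀ ω) (tsupport Ψ₀) :=
  (continuous_density hM hΨ hω).continuousOn.integrableOn_compact hs.isCompact

theorem hasCompactSupport_apply (hs : HasCompactSupport Ψ₀) (i : Fin 2) :
    HasCompactSupport fun v => Ψ₀ v i :=
  hs.comp_left (g := fun z : Fin 2 → ℂ => z i) rfl

/-- The two components of the integrand in terms of the pairings of the kernel with the components
of the initial data. -/
theorem spectralIntegrand_eq (hM : 0 < M) (hΨ : Continuous Ψ₀) (hs : HasCompactSupport Ψ₀) {ω : ℝ}
    (hω : ω ≠ 0) :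
    spectralIntegrand M u Ψ₀ ω =
      ContinuousLinearMap.single ℝ (fun _ : Fin 2 => ℂ) 0
        (ω • pairing M u (fun v => Ψ₀ v 0) ω + pairing M u (fun v => Ψ₀ v 1) ω) +
      ContinuousLinearMap.single ℝ (fun _ : Fin 2 => ℂ) 1
        (ω • ω • pairing M u (fun v => Ψ₀ v 0) ω + ω • pairing M u (fun v => Ψ₀ v 1) ω) := by
  have hcomp : ∀ i, Integrable fun v => (kernel M ω u v : ℂ) * Ψ₀ v i := fun i =>
    ((continuous_kernel hM hω u).mul
      ((continuous_apply i).comp hΨ)).integrable_of_hasCompactSupport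
        (hasCompactSupport_apply hs i).mul_left
  have hpair : ∀ (a b : ℂ), ∫ v in tsupport Ψ₀,
      (kernel M ω u v : ℂ) * (a * Ψ₀ v 0 + b * Ψ₀ v 1) =
        a * pairing M u (fun v => Ψ₀ v 0) ω + b * pairing M u (fun v => Ψ₀ v 1) ω := by
    intro a b
    rw [setIntegral_eq_integral_of_forall_compl_eq_zero fun v hv => by
      rw [image_eq_zero_of_notMem_tsupport hv]; simp]
    rw [pairing, pairing, ← integral_const_mul, ← integral_const_mul,
      ← integral_add ((hcomp 0).const_mul a) ((hcomp 1).const_mul b)]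
    refine integral_congr_ae (Eventually.of_forall fun v => ?_)
    simp only
    ring
  have hint : ∀ i, IntegrableOn (fun v => density M u Ψ₀ ω v i) (tsupport Ψ₀) := fun i =>
    ((continuous_apply i).comp (continuous_density hM hΨ hω)).continuousOn.integrableOn_compact
      hs.isCompact
  ext i
  rw [spectralIntegrand, eval_integral hint]
  fin_cases i
  · have := hpair ω 1
    simpa [density, Matrix.mulVec, dotProduct, Fin.sum_univ_two] using this
  · have := hpair ((ω : ℂ) ^ 2) ω
    rw [sq] at this
    simpa [density, Matrix.mulVec, dotProduct, Fin.sum_univ_two, mul_assoc, sq] using this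

theorem rapid_spectralIntegrand (hM : 0 < M) (hΨ : ContDiff ℝ ((⊤ : ℕ∞) : WithTop ℕ∞) Ψ₀)
    (hs : HasCompactSupport Ψ₀) : Rapid (spectralIntegrand M u Ψ₀) := by
  have h : ∀ i, Rapid (pairing M u fun v => Ψ₀ v i) := fun i =>
    rapid_pairing hM u (contDiff_pi.1 hΨ i) (hasCompactSupport_apply hs i)
  exact (((h 0).id_smul.add (h 1)).clm _ |>.add
    (((h 0).id_smul.id_smul.add (h 1).id_smul).clm _)).congr fun ω hω =>
      spectralIntegrand_eq hM hΨ.continuous hs hω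

end Spectral

end Schwarzschild

theorem mainTheorem4 (M : ℝ) (hM : 0 < M) (u : ℝ) (Ψ₀ : ℝ → Fin 2 → ℂ)
    (hΨ₀ : ContDiff ℝ ((⊤ : ℕ∞) : WithTop ℕ∞) Ψ₀) (hsupp : HasCompactSupport Ψ₀) :
    -- for real `ω ≠ 0` all objects in the integrand are well defined
    (∀ ω : ℝ, ω ≠ 0 →
      Schwarzschild.IsAcuteSolution M ω (Schwarzschild.acute M ω) ∧
      Schwarzschild.IsGraveSolution M ω (Schwarzschild.grave M ω) ∧
      (∀ x : ℝ, Schwarzschild.wronskian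
        (Schwarzschild.acute M ω) (Schwarzschild.grave M ω) x ≠ 0) ∧
      MeasureTheory.IntegrableOn (Schwarzschild.density M u Ψ₀ ω) (tsupport Ψ₀)) ∧
    -- the derivatives up to order four exist for `ω ≠ 0`
    ContDiffOn ℝ 4 (Schwarzschild.spectralIntegrand M u Ψ₀) {ω : ℝ | ω ≠ 0} ∧
    -- and they decay faster than any power of `ω`
    ∀ m : ℕ, m ≤ 4 → ∀ N : ℕ, ∃ C R : ℝ, 0 < R ∧ ∀ ω : ℝ, R ≤ |ω| →
      ‖iteratedDeriv m (Schwarzschild.spectralIntegrand M u Ψ₀) ω‖ ≤ C / |ω| ^ N := by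
  have h := Schwarzschild.rapid_spectralIntegrand (u := u) hM hΨ₀ hsupp
  refine ⟨fun ω hω => ⟨Schwarzschild.isAcuteSolution_acute hM hω,
    Schwarzschild.isGraveSolution_grave hM hω, Schwarzschild.wronskian_ne_zero hM hω,
    Schwarzschild.integrableOn_density hM hΨ₀.continuous hsupp hω⟩, ?_,
    fun m _ N => (h.iteratedDeriv m).norm_le N⟩
  exact_mod_cast h.contDiffOn 4
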